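/- Let $p_1<p_2<\cdots$ be the primes in increasing order. For $N\ge1$ let $\Omega_N$ be the set of positive integers with no prime factor larger than $p_N$, and let $P_N$ be the probability measure on $\Omega_N$ that gives each $n\in\Omega_N$ a probability proportional to $\frac1n$. For $k\ge2$ let $S_k$ be the set of $k$-free positive integers (those $n$ with $p^k\nmid n$ for every prime $p$), and let $P_N^{(k)}=P_N(\,\cdot\mid S_k)$. Let $\rho$ be the Dickman function, that is, the unique continuous function on $(0,\infty)$ with $\rho(x)=1$ for $0<x\le1$ and $x\rho'(x)+\rho(x-1)=0$ for $x>1$, and let $\gamma$ be Euler's constant. Then $e^{-\gamma}\rho(x)$, $x\ge 0$, is a probability density on $[0,\infty)$; its distribution is called the Dickman distribution. As $N\to\infty$, the random variable $\frac{\log n}{\log N}$ converges weakly to the Dickman distribution, both under $P_N$ and, for every $k\ge2$, under $P_N^{(k)}$. Moreover, for every $t\ge0$, the Laplace transforms $E\exp\left(-t\frac{\log n}{\log N}\right)$ under $P_N$ and, for every $k\ge2$, under $P_N^{(k)}$, converge as $N\to\infty$ to $$\exp\left(-\int_0^1\frac{1-e^{-tx}}{x}\,dx\right).$$ -/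

import Mathlib

open MeasureTheory ProbabilityTheory Filter Topology
open scoped ENNReal

noncomputable section

namespace DickmanLimit

/-! ### The integers without prime factor above the `N`-th prime -/

/-- The `j`-th prime `p_j` for `j ≥ 1`: `p_1 = 2`, `p_2 = 3`, `p_3 = 5`, … -/
def nthPrime (j : ℕ) : ℕ := Nat.nth Nat.Prime (j - 1)

/-- `Ω_N`: the positive integers divisible by no `p_j` with `j > N`. -/
def Omega (N : ℕ) : Set ℕ := {n | 0 < n ∧ ∀ j, N < j → ¬ nthPrime j ∣ n}

/-- The set `S_k` of all `k`-free positive integers. -/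
def kFree (k : ℕ) : Set ℕ := {n | 0 < n ∧ ∀ p : ℕ, p.Prime → ¬ p ^ k ∣ n}

/-- The weight `1 / n` on `Ω_N`, extended by `0` to `ℕ`. -/
def weight (N : ℕ) : ℕ → ℝ≥0∞ := (Omega N).indicator fun n => (n : ℝ≥0∞)⁻¹

lemma one_mem_Omega (N : ℕ) : 1 ∈ Omega N := by
  refine ⟨one_pos, fun j _ h => ?_⟩
  exact (Nat.prime_nth_prime (j - 1)).one_lt.ne' (Nat.dvd_one.mp h)

lemma Omega_subset_smoothNumbers (N : ℕ) :
    Omega N ⊆ Nat.smoothNumbers (Nat.nth Nat.Prime N) := by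
  rintro n ⟨hn, h⟩
  refine ⟨hn.ne', fun p hp => ?_⟩
  have hpp := Nat.prime_of_mem_primeFactorsList hp
  by_contra! hle
  have hcount : N ≤ Nat.count Nat.Prime p := by
    have := Nat.count_monotone Nat.Prime hle
    rwa [Nat.count_nth_of_infinite Nat.infinite_setOfPred_prime] at this
  refine h (Nat.count Nat.Prime p + 1) (by omega) ?_
  rw [nthPrime, Nat.add_sub_cancel, Nat.nth_count hpp]
  exact Nat.dvd_of_mem_primeFactorsList hp

lemma tsum_weight_ne_zero (N : ℕ) : ∑' n, weight N n ≠ 0 := by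
  intro h
  have := ENNReal.tsum_eq_zero.mp h 1
  simp [weight, one_mem_Omega N] at this

lemma summable_inv_smoothNumbers (M : ℕ) :
    Summable fun m : Nat.smoothNumbers M => ((m : ℕ) : ℝ)⁻¹ := by
  let f : ℕ →* ℝ :=
    { toFun := fun n => (n : ℝ)⁻¹
      map_one' := by simp
      map_mul' := fun a b => by push_cast; rw [mul_inv] }
  have h := (EulerProduct.summable_and_hasSum_smoothNumbers_prod_primesBelow_geometric
    (f := f) (fun {p} hp => by
      have : (1 : ℝ) < p := by exact_mod_cast hp.one_lt
      simpa [f] using inv_lt_one_of_one_lt₀ this) M).1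
  simpa [f] using h

lemma tsum_weight_ne_top (N : ℕ) : ∑' n, weight N n ≠ ∞ := by
  set M := Nat.nth Nat.Prime N
  have h1 : ∑' n, weight N n ≤ ∑' m : Nat.smoothNumbers M, ((m : ℕ) : ℝ≥0∞)⁻¹ := by
    rw [tsum_subtype (Nat.smoothNumbers M) fun n : ℕ => (n : ℝ≥0∞)⁻¹]
    refine ENNReal.tsum_le_tsum fun n => ?_
    exact Set.indicator_le_indicator_of_subset (Omega_subset_smoothNumbers N)
      (fun _ => zero_le) n
  refine ne_top_of_le_ne_top ?_ h1
  have h2 : ∀ m : Nat.smoothNumbers M,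
      ((m : ℕ) : ℝ≥0∞)⁻¹ = ENNReal.ofReal (((m : ℕ) : ℝ)⁻¹) := by
    intro m
    have : (0 : ℝ) < (m : ℕ) := by exact_mod_cast Nat.pos_of_ne_zero m.2.1
    rw [ENNReal.ofReal_inv_of_pos this, ENNReal.ofReal_natCast]
  simp_rw [h2]
  exact (summable_inv_smoothNumbers M).tsum_ofReal_ne_top

/-- `P_N`: the probability measure on `Ω_N` (as a measure on `ℕ` carried by `Ω_N`) which gives to
each `n ∈ Ω_N` a probability proportional to `1 / n`. -/
def P (N : ℕ) : Measure ℕ :=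
  (PMF.normalize (weight N) (tsum_weight_ne_zero N) (tsum_weight_ne_top N)).toMeasure

instance (N : ℕ) : IsProbabilityMeasure (P N) := by
  unfold P; infer_instance

/-- `P_N^{(k)} = P_N( · | S_k)`. -/
def Pfree (k N : ℕ) : Measure ℕ := ProbabilityTheory.cond (P N) (kFree k)

instance (k N : ℕ) [hk : k.AtLeastTwo] : IsProbabilityMeasure (Pfree k N) := by
  refine cond_isProbabilityMeasure fun h => ?_
  have h1 : (1 : ℕ) ∈ kFree k := by
    refine ⟨one_pos, fun p hp h => ?_⟩
    have := hk.prop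
    have h2 := Nat.dvd_one.mp h
    exact hp.one_lt.ne' ((Nat.pow_eq_one.mp h2).resolve_right (by omega))
  have h2 : P N {1} = 0 := measure_mono_null (by simpa using h1) h
  rw [P, PMF.toMeasure_apply_singleton _ _ (measurableSet_singleton _),
    PMF.normalize_apply] at h2
  simp [weight, one_mem_Omega N] at h2
  exact tsum_weight_ne_top N h2

/-! ### The Dickman function -/

/-- The defining properties of the Dickman function: continuous on `(0, ∞)`, equal to `1` on
`(0, 1]`, and `x ρ'(x) + ρ(x - 1) = 0` for `x > 1`. -/
structure IsDickmanFunction (ρ : ℝ → ℝ) : Prop where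
  continuousOn : ContinuousOn ρ (Set.Ioi 0)
  eq_one : ∀ x ∈ Set.Ioc (0 : ℝ) 1, ρ x = 1
  differentiableAt : ∀ x, 1 < x → DifferentiableAt ℝ ρ x
  delay : ∀ x, 1 < x → x * deriv ρ x + ρ (x - 1) = 0

/-- The `m`-th step of the solution of the differential-delay equation: it agrees with the Dickman
function on `(0, m + 1]`. -/
def dickmanStep : ℕ → ℝ → ℝ
  | 0, _ => 1
  | m + 1, x => 1 - ∫ t in (1 : ℝ)..max 1 x, dickmanStep m (t - 1) / t

/-- The Dickman function `ρ` (on `(0, ∞)`; the values at `x ≤ 0` are never used). -/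
def dickmanRho (x : ℝ) : ℝ := dickmanStep ⌈x⌉₊ x

lemma continuous_dickmanStep (m : ℕ) : Continuous (dickmanStep m) := by
  induction m with
  | zero => exact continuous_const
  | succ m ih =>
    have hc : Continuous fun t : ℝ => dickmanStep m (t - 1) / max 1 t := by
      refine (ih.comp (by fun_prop)).div (by fun_prop) fun t => ?_
      exact (lt_of_lt_of_le one_pos (le_max_left 1 t)).ne'
    have heq : dickmanStep (m + 1) =
        fun x => 1 - ∫ t in (1 : ℝ)..max 1 x, dickmanStep m (t - 1) / max 1 t := by
      funext x
      simp only [dickmanStep]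
      congr 1
      refine intervalIntegral.integral_congr fun t ht => ?_
      rw [Set.uIcc_of_le (le_max_left 1 x)] at ht
      simp only [max_eq_right ht.1]
    rw [heq]
    have hprim : Continuous fun y : ℝ => ∫ t in (1 : ℝ)..y, dickmanStep m (t - 1) / max 1 t :=
      intervalIntegral.continuous_primitive (fun a b => hc.intervalIntegrable a b) 1
    exact continuous_const.sub (hprim.comp (by fun_prop : Continuous fun x : ℝ => max 1 x))

lemma dickmanStep_succ_eq (m : ℕ) :
    ∀ x : ℝ, x ≤ m + 1 → dickmanStep (m + 1) x = dickmanStep m x := by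
  induction m with
  | zero =>
    intro x hx
    have : max 1 x = 1 := max_eq_left (by simpa using hx)
    simp [dickmanStep, this]
  | succ m ih =>
    intro x hx
    rw [dickmanStep, dickmanStep]
    congr 1
    refine intervalIntegral.integral_congr fun t ht => ?_
    rw [Set.uIcc_of_le (le_max_left 1 x)] at ht
    have h2 : t ≤ m + 2 := by
      refine ht.2.trans (max_le ?_ ?_)
      · have : (0 : ℝ) ≤ m := Nat.cast_nonneg m
        linarith
      · push_cast at hx; linarith
    simp only [ih (t - 1) (by linarith)]

lemma dickmanStep_eq_of_le {m n : ℕ} (hmn : m ≤ n) {x : ℝ} (hx : x ≤ m + 1) :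
    dickmanStep n x = dickmanStep m x := by
  induction n, hmn using Nat.le_induction with
  | base => rfl
  | succ n hn ih =>
    have : (m : ℝ) ≤ n := by exact_mod_cast hn
    rw [dickmanStep_succ_eq n x (by linarith), ih]

lemma dickmanRho_eq_step {m : ℕ} {x : ℝ} (hx : x ≤ m + 1) : dickmanRho x = dickmanStep m x := by
  rw [dickmanRho]
  rcases le_total m ⌈x⌉₊ with h | h
  · exact dickmanStep_eq_of_le h hx
  · exact (dickmanStep_eq_of_le h ((Nat.le_ceil x).trans (by linarith))).symm

lemma dickmanRho_eventuallyEq (x : ℝ) : dickmanRho =ᶠ[𝓝 x] dickmanStep (⌈x⌉₊ + 1) := by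
  have hx : x < ((⌈x⌉₊ + 1 : ℕ) : ℝ) + 1 := by
    push_cast
    linarith [Nat.le_ceil x]
  filter_upwards [Iio_mem_nhds hx] with y hy
  exact dickmanRho_eq_step hy.le

lemma continuous_dickmanRho : Continuous dickmanRho :=
  continuous_iff_continuousAt.mpr fun x =>
    (continuous_dickmanStep _).continuousAt.congr (dickmanRho_eventuallyEq x).symm

lemma hasDerivAt_dickmanRho {x : ℝ} (hx : 1 < x) :
    HasDerivAt dickmanRho (-(dickmanRho (x - 1) / x)) x := by
  set m := ⌈x⌉₊ with hm
  have h1 : dickmanRho (x - 1) = dickmanStep m (x - 1) :=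
    dickmanRho_eq_step (by linarith [Nat.le_ceil x])
  have hc : Continuous fun t : ℝ => dickmanStep m (t - 1) :=
    (continuous_dickmanStep m).comp (by fun_prop)
  have hcont : ContinuousOn (fun t : ℝ => dickmanStep m (t - 1) / t) (Set.Ioi 0) :=
    hc.continuousOn.div continuousOn_id fun t ht => (Set.mem_Ioi.mp ht).ne'
  have hint : IntervalIntegrable (fun t : ℝ => dickmanStep m (t - 1) / t) volume 1 x := by
    refine (hcont.mono fun t ht => ?_).intervalIntegrable
    rw [Set.uIcc_of_le hx.le] at ht
    exact lt_of_lt_of_le one_pos ht.1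
  have hd := (intervalIntegral.integral_hasDerivAt_right hint
    (hcont.stronglyMeasurableAtFilter isOpen_Ioi x (by simp; linarith))
    (hcont.continuousAt (Ioi_mem_nhds (by linarith)))).const_sub 1
  rw [h1]
  refine hd.congr_of_eventuallyEq ?_
  filter_upwards [dickmanRho_eventuallyEq x, Ioi_mem_nhds hx] with y hy hy1
  rw [hy, ← hm, dickmanStep, max_eq_right (Set.mem_Ioi.mp hy1).le]

/-- `dickmanRho` has the defining properties of the Dickman function. -/
theorem isDickmanFunction_dickmanRho : IsDickmanFunction dickmanRho where
  continuousOn := continuous_dickmanRho.continuousOn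
  eq_one x hx := by
    rw [dickmanRho_eq_step (m := 0) (by simpa using hx.2), dickmanStep]
  differentiableAt x hx := (hasDerivAt_dickmanRho hx).differentiableAt
  delay x hx := by
    rw [(hasDerivAt_dickmanRho hx).deriv]
    have : x ≠ 0 := by linarith
    field_simp
    ring

/-- The defining properties determine the Dickman function on `(0, ∞)`. -/
theorem IsDickmanFunction.eqOn {ρ₁ ρ₂ : ℝ → ℝ} (h₁ : IsDickmanFunction ρ₁)
    (h₂ : IsDickmanFunction ρ₂) : Set.EqOn ρ₁ ρ₂ (Set.Ioi 0) := by
  have key : ∀ m : ℕ, ∀ x : ℝ, 0 < x → x ≤ m + 1 → ρ₁ x = ρ₂ x := by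
    intro m
    induction m with
    | zero =>
      intro x hx0 hx
      have hx' : x ∈ Set.Ioc (0 : ℝ) 1 := ⟨hx0, by simpa using hx⟩
      rw [h₁.eq_one x hx', h₂.eq_one x hx']
    | succ m ih =>
      intro x hx0 hx
      rcases le_or_gt x 1 with hx1 | hx1
      · rw [h₁.eq_one x ⟨hx0, hx1⟩, h₂.eq_one x ⟨hx0, hx1⟩]
      have hsub : Set.Icc 1 x ⊆ Set.Ioi (0 : ℝ) := fun t ht => lt_of_lt_of_le one_pos ht.1
      obtain ⟨c, hc, hslope⟩ := exists_deriv_eq_slope (fun t => ρ₁ t - ρ₂ t) hx1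
        ((h₁.continuousOn.mono hsub).sub (h₂.continuousOn.mono hsub))
        (fun t ht => ((h₁.differentiableAt t ht.1).sub
          (h₂.differentiableAt t ht.1)).differentiableWithinAt)
      have hd : deriv (fun t => ρ₁ t - ρ₂ t) c = 0 := by
        have e := deriv_fun_sub (h₁.differentiableAt c hc.1) (h₂.differentiableAt c hc.1)
        have hcx : c - 1 ≤ m + 1 := by
          have := hc.2
          push_cast at hx
          linarith
        have e3 := ih (c - 1) (by linarith [hc.1]) hcx
        have e1 := h₁.delay c hc.1
        have e2 := h₂.delay c hc.1
        have hc0 : c ≠ 0 := by linarith [hc.1]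
        rw [e]
        have : c * (deriv ρ₁ c - deriv ρ₂ c) = 0 := by linear_combination e1 - e2 - e3
        exact (mul_eq_zero.mp this).resolve_left hc0
      have one_mem : (1 : ℝ) ∈ Set.Ioc (0 : ℝ) 1 := ⟨one_pos, le_rfl⟩
      rw [hd, h₁.eq_one 1 one_mem, h₂.eq_one 1 one_mem, eq_comm, div_eq_zero_iff] at hslope
      rcases hslope with h | h <;> linarith
  intro x hx
  exact key ⌈x⌉₊ x hx ((Nat.le_ceil x).trans (by linarith))

/-- The Dickman distribution: the measure on `ℝ` with density `e^{-γ} ρ(x)` on `[0, ∞)`. -/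
def dickmanMeasure : Measure ℝ :=
  (volume.restrict (Set.Ici 0)).withDensity fun x =>
    ENNReal.ofReal (Real.exp (-Real.eulerMascheroniConstant) * dickmanRho x)

end DickmanLimit

end

namespace DickmanLimit

/-! ### The Dickman function: positivity and decay -/

/-! Under `P N` the exponents of the first `N` primes are independent, so the Laplace transform of
log n at s is an Euler product with factors (1 - 1/p) / (1 - p^(-1-s)) (`integral_exp_log_P`). For s
= t / log N its logarithm is, up to O(s), minus the sum of (1 - exp(-t log p / log N)) / p over
these primes. Mertens' first theorem replaces the weights (log p)/p on primes by 1/i on all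
integers, and since log p_N ~ log N the sum tends to E(t), the integral of (1 - e^(-tx))/x over [0,
1] (`tendsto_sum_primesBelow`). Conditioning on `k`-free integers adds the factors (1 - p^(-k(1+s)))
/ (1 - p^(-k)); their product tends to 1 because ∑ (log p)/p² converges (`tendsto_prod_pow_div`).

It remains to recognise exp(-E) as the transform of e^(-γ) ρ. The delay equation integrates to xρ(x)
= ∫ ρ over [x-1, x], so xρ is the convolution of ρ with the indicator of (0, 1]. Hence the transform
L of ρ satisfies L' = -E' L, and L = c exp(-E). The constant is read off at infinity: n L(n) → 1,
and E(n) - log n → γ by comparison with harmonic numbers, so c = e^γ (`laplaceRho_eq`). At t = 0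
this gives total mass 1.

Pointwise convergence of Laplace transforms implies weak convergence by Weierstrass approximation in
the variable e^(-εx) (`tendsto_integral_of_tendsto_laplace`). -/

lemma dickmanRho_of_le_one {x : ℝ} (hx : x ≤ 1) : dickmanRho x = 1 := by
  rw [dickmanRho_eq_step (m := 0) (by simpa using hx), dickmanStep]

lemma hasDerivAt_integral_dickmanRho (x : ℝ) :
    HasDerivAt (fun x => ∫ y in (0 : ℝ)..x, dickmanRho y) (dickmanRho x) x :=
  intervalIntegral.integral_hasDerivAt_right (continuous_dickmanRho.intervalIntegrable _ _)
    (continuous_dickmanRho.stronglyMeasurableAtFilter _ _) continuous_dickmanRho.continuousAt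

/-- By the delay equation the difference of the two sides has derivative 0 beyond 1, and it vanishes
at 1. Positivity, decay and the convolution identity for ρ all rest on this form. -/
lemma mul_dickmanRho_eq_integral {x : ℝ} (hx : 1 ≤ x) :
    x * dickmanRho x = ∫ y in (x - 1)..x, dickmanRho y := by
  let F : ℝ → ℝ := fun x => ∫ y in (0 : ℝ)..x, dickmanRho y
  have hF : ∀ x, HasDerivAt F (dickmanRho x) x := hasDerivAt_integral_dickmanRho
  let φ : ℝ → ℝ := fun x => x * dickmanRho x - (F x - F (x - 1))
  have hderiv : ∀ y, 1 < y → HasDerivAt φ 0 y := by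
    intro y hy
    have h1 := (hasDerivAt_id y).mul (hasDerivAt_dickmanRho hy)
    have h2 : HasDerivAt (fun x => F (x - 1)) (dickmanRho (y - 1)) y :=
      (hF (y - 1)).comp_sub_const y 1
    have hy0 : y ≠ 0 := by linarith
    convert! h1.sub ((hF y).sub h2) using 1
    simp only [id]
    field_simp
    ring
  have hcont : Continuous φ := by
    have hFc : Continuous F := continuous_iff_continuousAt.mpr fun x => (hF x).continuousAt
    have := continuous_dickmanRho
    fun_prop
  have hφ1 : φ 1 = 0 := by
    have h1 : F 1 = 1 := by
      have : F 1 = ∫ y in (0 : ℝ)..1, (1 : ℝ) := by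
        refine intervalIntegral.integral_congr fun t ht => ?_
        rw [Set.uIcc_of_le zero_le_one] at ht
        exact dickmanRho_of_le_one ht.2
      simpa using this
    simp [φ, h1, F, dickmanRho_of_le_one le_rfl]
  have hφ : φ x = 0 := by
    rcases hx.eq_or_lt with rfl | hx
    · exact hφ1
    obtain ⟨c, -, hc⟩ := exists_hasDerivAt_eq_slope φ (fun _ => 0) hx hcont.continuousOn
      fun y hy => hderiv y hy.1
    rw [hφ1, eq_comm, div_eq_zero_iff] at hc
    rcases hc with h | h <;> linarith
  have hsub := intervalIntegral.integral_interval_sub_left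
    (continuous_dickmanRho.intervalIntegrable (μ := volume) 0 x)
    (continuous_dickmanRho.intervalIntegrable 0 (x - 1))
  simp only [φ, F] at hφ
  linarith

/-- At the first point z ≥ 1 where ρ ≤ 0, the number zρ(z) would be the integral of ρ over [z-1, z],
where ρ is still positive to the left of z. -/
lemma dickmanRho_pos (x : ℝ) : 0 < dickmanRho x := by
  by_contra! hx
  have hx1 : 1 < x := by
    by_contra! h
    rw [dickmanRho_of_le_one h] at hx
    linarith
  let S : Set ℝ := Set.Ici 1 ∩ {y | dickmanRho y ≤ 0}
  have hS : IsClosed S := isClosed_Ici.inter (isClosed_le continuous_dickmanRho continuous_const)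
  have hne : S.Nonempty := ⟨x, hx1.le, hx⟩
  have hbdd : BddBelow S := ⟨1, fun y hy => hy.1⟩
  have hmem : sInf S ∈ S := hS.csInf_mem hne hbdd
  set z := sInf S
  have hpos : ∀ y < z, 0 < dickmanRho y := by
    intro y hy
    by_contra! h
    have hy1 : 1 ≤ y := by
      by_contra! h'
      rw [dickmanRho_of_le_one h'.le] at h
      linarith
    exact absurd (csInf_le hbdd (show y ∈ S from ⟨hy1, h⟩)) (not_le.mpr hy)
  have hint : 0 < ∫ y in (z - 1)..z, dickmanRho y :=
    intervalIntegral.intervalIntegral_pos_of_pos_on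
      (continuous_dickmanRho.intervalIntegrable _ _) (fun y hy => hpos y hy.2) (by linarith)
  rw [← mul_dickmanRho_eq_integral hmem.1] at hint
  have hz1 : (1 : ℝ) ≤ z := hmem.1
  have hz2 : dickmanRho z ≤ 0 := hmem.2
  nlinarith

lemma antitone_dickmanRho : Antitone dickmanRho := by
  have h1 : AntitoneOn dickmanRho (Set.Ici 1) := by
    refine antitoneOn_of_deriv_nonpos (convex_Ici 1) continuous_dickmanRho.continuousOn ?_ ?_
    · intro x hx
      rw [interior_Ici] at hx
      exact (hasDerivAt_dickmanRho hx).differentiableAt.differentiableWithinAt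
    · intro x hx
      rw [interior_Ici] at hx
      rw [(hasDerivAt_dickmanRho hx).deriv]
      have : 0 < x := lt_trans one_pos hx
      have := dickmanRho_pos (x - 1)
      simp only [Left.neg_nonpos_iff]
      positivity
  intro x y hxy
  rcases le_total y 1 with hy | hy
  · rw [dickmanRho_of_le_one hy, dickmanRho_of_le_one (hxy.trans hy)]
  rcases le_total x 1 with hx | hx
  · rw [dickmanRho_of_le_one hx, ← dickmanRho_of_le_one le_rfl]
    exact h1 Set.self_mem_Ici hy hy
  · exact h1 hx hy hxy

lemma dickmanRho_le_one (x : ℝ) : dickmanRho x ≤ 1 := by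
  rw [← dickmanRho_of_le_one (min_le_right x 1)]
  exact antitone_dickmanRho (min_le_left x 1)

lemma mul_dickmanRho_le {x : ℝ} (hx : 1 ≤ x) : x * dickmanRho x ≤ dickmanRho (x - 1) := by
  rw [mul_dickmanRho_eq_integral hx]
  have h : ∫ y in (x - 1)..x, dickmanRho y ≤ ∫ _ in (x - 1)..x, dickmanRho (x - 1) := by
    refine intervalIntegral.integral_mono_on (by linarith)
      (continuous_dickmanRho.intervalIntegrable _ _) (by simp) fun y hy => ?_
    exact antitone_dickmanRho hy.1
  simpa using h

/-- Beyond 3, each unit step divides ρ by at least x > 3 > e. Below 3 the bound is trivial since ρ ≤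
1. -/
lemma dickmanRho_le_exp (x : ℝ) : dickmanRho x ≤ Real.exp (3 - x) := by
  have key : ∀ m : ℕ, ∀ x : ℝ, x ≤ 3 + m → dickmanRho x ≤ Real.exp (3 - x) := by
    intro m
    induction m with
    | zero =>
      intro x hx
      refine (dickmanRho_le_one x).trans (Real.one_le_exp ?_)
      simp only [Nat.cast_zero] at hx
      linarith
    | succ m ih =>
      intro x hx
      rcases le_or_gt x 3 with h3 | h3
      · exact (dickmanRho_le_one x).trans (Real.one_le_exp (by linarith))
      have h1 := mul_dickmanRho_le (x := x) (by linarith)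
      have h2 := ih (x - 1) (by push_cast at hx; linarith)
      have he : Real.exp (3 - (x - 1)) = Real.exp 1 * Real.exp (3 - x) := by
        rw [← Real.exp_add]
        ring_nf
      have he1 : Real.exp 1 ≤ 3 := by linarith [Real.exp_one_lt_d9]
      have hp := dickmanRho_pos x
      have hq := Real.exp_pos (3 - x)
      nlinarith
  exact key ⌈x⌉₊ x (by linarith [Nat.le_ceil x])

/-! ### The Laplace transform of the Dickman function -/

/-- The Laplace transform of the Dickman function. -/
noncomputable def laplaceRho (t : ℝ) : ℝ := ∫ y in Set.Ioi (0 : ℝ), dickmanRho y * Real.exp (-t * y)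

/-- The Laplace exponent `∫₀¹ (1 - e^{-tx}) / x dx` of the Dickman distribution. -/
noncomputable def laplaceExponent (t : ℝ) : ℝ := ∫ x in (0 : ℝ)..1, (1 - Real.exp (-t * x)) / x

lemma integrableOn_dickmanRho_mul_exp {t : ℝ} (ht : 0 ≤ t) :
    IntegrableOn (fun y => dickmanRho y * Real.exp (-t * y)) (Set.Ioi 0) := by
  have hb : IntegrableOn (fun y : ℝ => Real.exp 3 * Real.exp (-1 * y)) (Set.Ioi 0) :=
    (integrableOn_exp_mul_Ioi (by norm_num) 0).const_mul _
  refine Integrable.mono' hb ?_ ?_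
  · have := continuous_dickmanRho
    exact Continuous.aestronglyMeasurable (by fun_prop)
  · refine (ae_restrict_iff' measurableSet_Ioi).mpr (.of_forall fun y hy => ?_)
    have hy : 0 < y := hy
    have h1 := dickmanRho_pos y
    rw [Real.norm_of_nonneg (by positivity), ← Real.exp_add]
    calc dickmanRho y * Real.exp (-t * y) ≤ Real.exp (3 - y) * 1 := by
          refine mul_le_mul (dickmanRho_le_exp y) (Real.exp_le_one_iff.mpr ?_) (by positivity)
            (by positivity)
          nlinarith
      _ = Real.exp (3 + -1 * y) := by ring_nf

lemma hasDerivAt_laplaceRho {t : ℝ} (ht : 0 ≤ t) :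
    HasDerivAt laplaceRho
      (-∫ y in Set.Ioi (0 : ℝ), (y * dickmanRho y) * Real.exp (-t * y)) t := by
  have hρ := continuous_dickmanRho
  rw [← integral_neg]
  refine (hasDerivAt_integral_of_dominated_loc_of_deriv_le (μ := volume.restrict (Set.Ioi 0))
    (F := fun t y => dickmanRho y * Real.exp (-t * y))
    (F' := fun t y => -((y * dickmanRho y) * Real.exp (-t * y)))
    (s := Metric.ball t (1 / 2))
    -- On the ball s > -1/2, so the integrand is at most y e^(3-y) e^(y/2), and y ≤ 4 e^(y/4) leaves
    -- the decay e^(-y/4).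
    (bound := fun y => 4 * Real.exp 3 * Real.exp (-(1 / 4) * y))
    (Metric.ball_mem_nhds t (by norm_num)) (.of_forall fun s => ?_)
    (integrableOn_dickmanRho_mul_exp ht) ?_ ?_ ?_ ?_).2
  · exact Continuous.aestronglyMeasurable (by fun_prop)
  · exact Continuous.aestronglyMeasurable (by fun_prop)
  · refine (ae_restrict_iff' measurableSet_Ioi).mpr (.of_forall fun y hy s hs => ?_)
    have hy : 0 < y := hy
    rw [Metric.mem_ball, Real.dist_eq, abs_lt] at hs
    have h1 := dickmanRho_pos y
    rw [norm_neg, Real.norm_of_nonneg (by positivity)]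
    have h2 : y ≤ 4 * Real.exp (1 / 4 * y) := by linarith [Real.add_one_le_exp (1 / 4 * y)]
    calc y * dickmanRho y * Real.exp (-s * y)
        ≤ 4 * Real.exp (1 / 4 * y) * Real.exp (3 - y) * Real.exp (1 / 2 * y) := by
          have := dickmanRho_le_exp y
          have : -s * y ≤ 1 / 2 * y := by nlinarith
          gcongr
      _ = 4 * Real.exp 3 * Real.exp (-(1 / 4) * y) := by
          rw [mul_assoc, mul_assoc, mul_assoc, ← Real.exp_add, ← Real.exp_add, ← Real.exp_add]
          ring_nf
  · exact (integrableOn_exp_mul_Ioi (by norm_num) 0).const_mul _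
  · refine .of_forall fun y s _ => ?_
    have h := (((hasDerivAt_id s).neg.mul_const y).exp).const_mul (dickmanRho y)
    convert! h using 1
    simp only [id, Pi.neg_apply]
    ring

/-- The function xρ(x) on (0, ∞) is the convolution of the indicator of (0, 1] with ρ cut off at 0.
The factor e^(-tx) splits as e^(-tu) e^(-t(x-u)), and the integral of a convolution is the product
of the integrals. -/
lemma integral_mul_dickmanRho_mul_exp {t : ℝ} (ht : 0 ≤ t) :
    ∫ y in Set.Ioi (0 : ℝ), (y * dickmanRho y) * Real.exp (-t * y) =
      (∫ u in (0 : ℝ)..1, Real.exp (-t * u)) * laplaceRho t := by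
  let f : ℝ → ℝ := (Set.Ioc 0 1).indicator fun u => Real.exp (-t * u)
  let g : ℝ → ℝ := (Set.Ioi 0).indicator fun y => dickmanRho y * Real.exp (-t * y)
  have hf : Integrable f := by
    refine (integrable_indicator_iff measurableSet_Ioc).mpr ?_
    exact (Continuous.integrableOn_Icc (by fun_prop)).mono_set Set.Ioc_subset_Icc_self
  have hg : Integrable g :=
    (integrable_indicator_iff measurableSet_Ioi).mpr (integrableOn_dickmanRho_mul_exp ht)
  have hconv := integral_convolution (ContinuousLinearMap.mul ℝ ℝ) hf hg
  have hf' : ∫ u, f u = ∫ u in (0 : ℝ)..1, Real.exp (-t * u) := by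
    rw [integral_indicator measurableSet_Ioc, intervalIntegral.integral_of_le zero_le_one]
  have hg' : ∫ y, g y = laplaceRho t := integral_indicator measurableSet_Ioi
  rw [hf', hg', ContinuousLinearMap.mul_apply'] at hconv
  rw [← hconv, ← integral_indicator measurableSet_Ioi]
  congr 1
  funext x
  rw [convolution_def]
  have e1 : ∀ u, ContinuousLinearMap.mul ℝ ℝ (f u) (g (x - u)) =
      (Set.Ioc 0 1 ∩ Set.Iio x).indicator
        (fun u => Real.exp (-t * x) * dickmanRho (x - u)) u := by
    intro u
    simp only [f, g, ContinuousLinearMap.mul_apply', Set.indicator, Set.mem_Ioc, Set.mem_Ioi,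
      Set.mem_inter_iff, Set.mem_Iio, sub_pos]
    by_cases h1 : 0 < u ∧ u ≤ 1 <;> by_cases h2 : u < x <;> simp [h1, h2]
    rw [mul_left_comm, ← Real.exp_add, mul_comm]
    ring_nf
  simp_rw [e1]
  rw [integral_indicator (measurableSet_Ioc.inter measurableSet_Iio), integral_const_mul]
  by_cases hx : 0 < x
  · rw [Set.indicator_of_mem (show x ∈ Set.Ioi (0 : ℝ) from hx), mul_comm]
    congr 1
    -- For x ≤ 1 the window is cut to (0, x), where ρ = 1; for x > 1 it is the full window of
    -- `mul_dickmanRho_eq_integral`.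
    rcases le_or_gt x 1 with hx1 | hx1
    · have e2 : Set.Ioc 0 1 ∩ Set.Iio x = Set.Ioo 0 x := by
        ext u
        simp only [Set.mem_inter_iff, Set.mem_Ioc, Set.mem_Iio, Set.mem_Ioo]
        constructor
        · rintro ⟨⟨h1, -⟩, h2⟩
          exact ⟨h1, h2⟩
        · rintro ⟨h1, h2⟩
          exact ⟨⟨h1, by linarith⟩, h2⟩
      rw [e2, setIntegral_congr_fun (g := fun _ => (1 : ℝ)) measurableSet_Ioo
        fun u hu => dickmanRho_of_le_one (by linarith [hu.1]), dickmanRho_of_le_one hx1]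
      simp [hx.le]
    · have e2 : Set.Ioc 0 1 ∩ Set.Iio x = Set.Ioc 0 1 := by
        refine Set.inter_eq_left.mpr fun u hu => ?_
        exact lt_of_le_of_lt hu.2 hx1
      rw [e2, ← intervalIntegral.integral_of_le zero_le_one,
        intervalIntegral.integral_comp_sub_left (fun y => dickmanRho y), sub_zero,
        mul_dickmanRho_eq_integral hx1.le]
  · rw [Set.indicator_of_notMem (show x ∉ Set.Ioi (0 : ℝ) from hx)]
    have e2 : Set.Ioc 0 1 ∩ Set.Iio x = ∅ := by
      ext u
      simp only [Set.mem_inter_iff, Set.mem_Ioc, Set.mem_Iio, Set.mem_empty_iff_false, iff_false]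
      rintro ⟨⟨h1, -⟩, h2⟩
      exact hx (h1.trans h2)
    simp [e2]

lemma one_sub_exp_div_mem_Icc {t x : ℝ} (ht : 0 ≤ t) (hx : 0 < x) :
    (1 - Real.exp (-t * x)) / x ∈ Set.Icc 0 t := by
  refine ⟨div_nonneg ?_ hx.le, (div_le_iff₀ hx).mpr ?_⟩
  · have : Real.exp (-t * x) ≤ 1 := Real.exp_le_one_iff.mpr (by nlinarith)
    linarith
  · linarith [Real.add_one_le_exp (-t * x)]

lemma intervalIntegrable_one_sub_exp_div {t : ℝ} (ht : 0 ≤ t) :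
    IntervalIntegrable (fun x => (1 - Real.exp (-t * x)) / x) volume 0 1 := by
  rw [intervalIntegrable_iff_integrableOn_Ioc_of_le zero_le_one]
  refine Integrable.mono' (g := fun _ => t) (by simp) ?_ ?_
  · exact Measurable.aestronglyMeasurable (by fun_prop)
  · refine (ae_restrict_iff' measurableSet_Ioc).mpr (.of_forall fun x hx => ?_)
    have h := one_sub_exp_div_mem_Icc ht hx.1
    rw [Real.norm_of_nonneg h.1]
    exact h.2

lemma hasDerivAt_laplaceExponent {t : ℝ} (ht : 0 ≤ t) :
    HasDerivAt laplaceExponent (∫ u in (0 : ℝ)..1, Real.exp (-t * u)) t := by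
  refine (intervalIntegral.hasDerivAt_integral_of_dominated_loc_of_deriv_le
    (F := fun t x => (1 - Real.exp (-t * x)) / x) (F' := fun t x => Real.exp (-t * x))
    (s := Metric.ball t 1) (bound := fun _ => Real.exp 1)
    (Metric.ball_mem_nhds t one_pos) (.of_forall fun s => ?_)
    (intervalIntegrable_one_sub_exp_div ht) ?_ ?_ (by simp) ?_).2
  · exact Measurable.aestronglyMeasurable (by fun_prop)
  · exact Measurable.aestronglyMeasurable (by fun_prop)
  · refine .of_forall fun x hx s hs => ?_
    rw [Set.uIoc_of_le zero_le_one] at hx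
    rw [Metric.mem_ball, Real.dist_eq, abs_lt] at hs
    rw [Real.norm_of_nonneg (Real.exp_pos _).le]
    exact Real.exp_le_exp.mpr (by nlinarith [hx.1, hx.2])
  · refine .of_forall fun x hx s _ => ?_
    rw [Set.uIoc_of_le zero_le_one] at hx
    have h := (((hasDerivAt_id s).neg.mul_const x).exp.const_sub 1).div_const x
    have hx0 : x ≠ 0 := hx.1.ne'
    convert! h using 1
    simp only [id, Pi.neg_apply]
    field_simp

/-- The convolution identity says L' = -E' L, so L exp(E) has derivative 0. -/
lemma laplaceRho_mul_exp_laplaceExponent {t : ℝ} (ht : 0 ≤ t) :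
    laplaceRho t * Real.exp (laplaceExponent t) =
      laplaceRho 0 * Real.exp (laplaceExponent 0) := by
  have hd : ∀ s, 0 ≤ s →
      HasDerivAt (fun s => laplaceRho s * Real.exp (laplaceExponent s)) 0 s := by
    intro s hs
    have h := (hasDerivAt_laplaceRho hs).mul (hasDerivAt_laplaceExponent hs).exp
    rw [integral_mul_dickmanRho_mul_exp hs] at h
    convert! h using 1
    ring
  exact constant_of_has_deriv_right_zero
    (fun s hs => (hd s hs.1).continuousAt.continuousWithinAt)
    (fun s hs => (hd s hs.1).hasDerivWithinAt) t ⟨ht, le_rfl⟩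

/-- For large n the transform only sees ρ near 0, where it equals 1: the bound ρ ≤ 1 gives the upper
estimate, restriction to (0, 1] the lower one. -/
lemma tendsto_mul_laplaceRho : Tendsto (fun n : ℕ => n * laplaceRho n) atTop (𝓝 1) := by
  have hexp : ∀ c n : ℝ, 0 < n →
      ∫ y in Set.Ioi c, Real.exp (-n * y) = Real.exp (-n * c) / n := by
    intro c n hn
    rw [integral_exp_mul_Ioi (by linarith), neg_div_neg_eq]
  have hlow : Tendsto (fun n : ℕ => 1 - Real.exp (-(n : ℝ))) atTop (𝓝 1) := by
    simpa using (Real.tendsto_exp_neg_atTop_nhds_zero.comp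
      tendsto_natCast_atTop_atTop).const_sub 1
  refine tendsto_of_tendsto_of_tendsto_of_le_of_le' hlow tendsto_const_nhds ?_ ?_
  · filter_upwards [eventually_gt_atTop 0] with n hn
    have hn' : (0 : ℝ) < n := by exact_mod_cast hn
    have hint := integrableOn_dickmanRho_mul_exp hn'.le
    have h1 : ∫ y in Set.Ioc (0 : ℝ) 1, dickmanRho y * Real.exp (-n * y) ≤ laplaceRho n := by
      refine setIntegral_mono_set hint (.of_forall fun y => ?_)
        (Set.Ioc_subset_Ioi_self).eventuallyLE
      have := dickmanRho_pos y
      positivity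
    have h2 : ∫ y in Set.Ioc (0 : ℝ) 1, dickmanRho y * Real.exp (-n * y) =
        (1 - Real.exp (-(n : ℝ))) / n := by
      rw [setIntegral_congr_fun (g := fun y => Real.exp (-n * y)) measurableSet_Ioc
        fun y hy => by simp [dickmanRho_of_le_one hy.2],
        ← intervalIntegral.integral_of_le zero_le_one]
      have h := intervalIntegral.integral_interval_add_Ioi
        (integrableOn_exp_mul_Ioi (by linarith : -(n : ℝ) < 0) 0)
        (integrableOn_exp_mul_Ioi (by linarith : -(n : ℝ) < 0) 1)
      rw [hexp _ _ hn', hexp _ _ hn'] at h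
      simp only [mul_zero, Real.exp_zero, mul_one] at h
      rw [sub_div]
      linarith
    rw [h2, div_le_iff₀ hn'] at h1
    linarith
  · filter_upwards [eventually_gt_atTop 0] with n hn
    have hn' : (0 : ℝ) < n := by exact_mod_cast hn
    have h1 : laplaceRho n ≤ ∫ y in Set.Ioi (0 : ℝ), Real.exp (-n * y) := by
      refine setIntegral_mono (integrableOn_dickmanRho_mul_exp hn'.le)
        (integrableOn_exp_mul_Ioi (by linarith) 0) fun y => ?_
      exact mul_le_of_le_one_left (Real.exp_pos _).le (dickmanRho_le_one y)
    rw [hexp _ _ hn', mul_zero, Real.exp_zero, le_div_iff₀ hn'] at h1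
    linarith

lemma integral_sum_one_sub_pow (n : ℕ) :
    ∫ u in (0 : ℝ)..1, ∑ k ∈ Finset.range n, (1 - u) ^ k = harmonic n := by
  rw [intervalIntegral.integral_finsetSum fun k _ =>
    Continuous.intervalIntegrable (by fun_prop) _ _, harmonic]
  push_cast
  refine Finset.sum_congr rfl fun k _ => ?_
  rw [intervalIntegral.integral_comp_sub_left (fun u => u ^ k)]
  simp

lemma integral_mul_exp_le {n : ℝ} (hn : 0 < n) :
    ∫ u in (0 : ℝ)..1, n * u * Real.exp (-n * u) ≤ 1 / n := by
  have hd : ∀ u : ℝ, HasDerivAt (fun u => -(u + 1 / n) * Real.exp (-n * u))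
      (n * u * Real.exp (-n * u)) u := by
    intro u
    have h := (((hasDerivAt_id u).add_const (1 / n)).neg).mul
      ((hasDerivAt_id u).const_mul (-n)).exp
    convert! h using 1
    simp only [id, Pi.neg_apply]
    field_simp
    ring
  rw [intervalIntegral.integral_eq_sub_of_hasDerivAt (fun u _ => hd u)
    (Continuous.intervalIntegrable (by fun_prop) _ _)]
  simp only [mul_zero, Real.exp_zero, mul_one, zero_add, sub_neg_eq_add]
  have : 0 < (1 + 1 / n) * Real.exp (-n) := by positivity
  linarith

/-- The harmonic number is the integral of (1 - (1-u)^n)/u, so the difference is the integral of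
((1-u)^n - e^(-nu))/u. The numerator lies between -n u² e^(-nu) and 0. -/
lemma abs_laplaceExponent_sub_harmonic_le {n : ℕ} (hn : 0 < n) :
    |laplaceExponent n - harmonic n| ≤ 1 / n := by
  have hn' : (0 : ℝ) < n := by exact_mod_cast hn
  have hI : IntervalIntegrable (fun u : ℝ => ∑ k ∈ Finset.range n, (1 - u) ^ k) volume 0 1 :=
    Continuous.intervalIntegrable (by fun_prop) _ _
  rw [← integral_sum_one_sub_pow, laplaceExponent,
    ← intervalIntegral.integral_sub (intervalIntegrable_one_sub_exp_div hn'.le) hI,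
    ← Real.norm_eq_abs]
  refine le_trans ?_ (integral_mul_exp_le hn')
  refine intervalIntegral.norm_integral_le_of_norm_le zero_le_one ?_
    (Continuous.intervalIntegrable (by fun_prop) _ _)
  refine .of_forall fun u hu => ?_
  have hu0 : 0 < u := hu.1
  have hsum : ∑ k ∈ Finset.range n, (1 - u) ^ k = (1 - (1 - u) ^ n) / u := by
    rw [geom_sum_eq (by linarith)]
    rw [show 1 - u - 1 = -u by ring, div_neg, ← neg_div, neg_sub]
  have hpow : Real.exp (-n * u) = Real.exp (-u) ^ n := by
    rw [← Real.exp_nat_mul]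
    ring_nf
  have hle : (1 - u) ^ n ≤ Real.exp (-n * u) := by
    rw [hpow]
    exact pow_le_pow_left₀ (by linarith [hu.2]) (Real.one_sub_le_exp_neg u) n
  -- From 1 - u ≥ e^(-u) (1 - u²), raised to the power n, and Bernoulli's inequality.
  have hge : Real.exp (-n * u) * (1 - n * u ^ 2) ≤ (1 - u) ^ n := by
    have h1 : Real.exp (-u) * (1 - u ^ 2) ≤ 1 - u := by
      have h2 : Real.exp (-u) * (1 + u) ≤ 1 := by
        rw [Real.exp_neg, inv_mul_le_iff₀ (Real.exp_pos u)]
        linarith [Real.add_one_le_exp u]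
      nlinarith [hu.2]
    have h3 : 1 - n * u ^ 2 ≤ (1 - u ^ 2) ^ n := by
      have := one_add_mul_le_pow (a := -u ^ 2) (by nlinarith [hu.2]) n
      calc 1 - n * u ^ 2 = 1 + n * (-u ^ 2) := by ring
        _ ≤ (1 + -u ^ 2) ^ n := this
        _ = _ := by ring_nf
    calc Real.exp (-n * u) * (1 - n * u ^ 2)
        ≤ Real.exp (-n * u) * (1 - u ^ 2) ^ n := by gcongr
      _ = (Real.exp (-u) * (1 - u ^ 2)) ^ n := by rw [hpow, mul_pow]
      _ ≤ (1 - u) ^ n := by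
        refine pow_le_pow_left₀ (mul_nonneg (Real.exp_pos _).le ?_) h1 n
        nlinarith [hu.2]
  rw [hsum, ← sub_div, Real.norm_eq_abs, abs_le]
  constructor
  · rw [le_div_iff₀ hu0]
    nlinarith
  · rw [div_le_iff₀ hu0]
    have : 0 ≤ n * u * Real.exp (-n * u) * u := by positivity
    linarith

lemma tendsto_laplaceExponent_sub_log :
    Tendsto (fun n : ℕ => laplaceExponent n - Real.log n) atTop
      (𝓝 Real.eulerMascheroniConstant) := by
  have h : Tendsto (fun n : ℕ => laplaceExponent n - harmonic n) atTop (𝓝 0) := by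
    refine squeeze_zero_norm' ?_ tendsto_one_div_atTop_nhds_zero_nat
    filter_upwards [eventually_gt_atTop 0] with n hn
    exact abs_laplaceExponent_sub_harmonic_le hn
  simpa using h.add Real.tendsto_harmonic_sub_log

/-- The Laplace transform of the Dickman function. -/
theorem laplaceRho_eq {t : ℝ} (ht : 0 ≤ t) :
    laplaceRho t = Real.exp Real.eulerMascheroniConstant * Real.exp (-laplaceExponent t) := by
  -- The product is constant in t, so its value is its limit along the integers; the factors n and
  -- 1/n from the two asymptotics cancel.
  have hlim : Tendsto (fun n : ℕ => laplaceRho n * Real.exp (laplaceExponent n)) atTop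
      (𝓝 (Real.exp Real.eulerMascheroniConstant)) := by
    have h := tendsto_mul_laplaceRho.mul
      ((Real.continuous_exp.tendsto _).comp tendsto_laplaceExponent_sub_log)
    rw [one_mul] at h
    refine h.congr' ?_
    filter_upwards [eventually_gt_atTop 0] with n hn
    have hn' : (0 : ℝ) < n := by exact_mod_cast hn
    rw [Function.comp_apply, Real.exp_sub, Real.exp_log hn']
    field_simp
  have hconst : laplaceRho 0 * Real.exp (laplaceExponent 0) =
      Real.exp Real.eulerMascheroniConstant := by
    refine tendsto_nhds_unique (tendsto_const_nhds.congr fun n : ℕ => ?_) hlim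
    exact (laplaceRho_mul_exp_laplaceExponent (Nat.cast_nonneg n)).symm
  rw [← hconst, ← laplaceRho_mul_exp_laplaceExponent ht, mul_assoc, ← Real.exp_add]
  simp

lemma laplaceExponent_zero : laplaceExponent 0 = 0 := by simp [laplaceExponent]

/-! ### The Dickman distribution -/

lemma isProbabilityMeasure_dickmanMeasure : IsProbabilityMeasure dickmanMeasure := by
  constructor
  have hI := integrableOn_dickmanRho_mul_exp le_rfl
  simp only [neg_zero, zero_mul, Real.exp_zero, mul_one] at hI
  have h0 := laplaceRho_eq le_rfl
  simp only [laplaceRho, neg_zero, zero_mul, Real.exp_zero, mul_one, laplaceExponent_zero] at h0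
  rw [dickmanMeasure, withDensity_apply _ MeasurableSet.univ, Measure.restrict_univ,
    Measure.restrict_congr_set Ioi_ae_eq_Ici.symm, ← ofReal_integral_eq_lintegral_ofReal (hI.const_mul _)
    (.of_forall fun x => mul_nonneg (Real.exp_pos _).le (dickmanRho_pos x).le),
    integral_const_mul, h0, ← Real.exp_add]
  simp

lemma integral_exp_dickmanMeasure {t : ℝ} (ht : 0 ≤ t) :
    ∫ x, Real.exp (-t * x) ∂dickmanMeasure = Real.exp (-laplaceExponent t) := by
  have hm : Measurable fun x => Real.toNNReal
      (Real.exp (-Real.eulerMascheroniConstant) * dickmanRho x) := by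
    have := continuous_dickmanRho
    exact Continuous.measurable (by fun_prop)
  have h : dickmanMeasure = (volume.restrict (Set.Ici 0)).withDensity fun x =>
    ((Real.toNNReal (Real.exp (-Real.eulerMascheroniConstant) * dickmanRho x)) : ℝ≥0∞) := rfl
  rw [h, integral_withDensity_eq_integral_smul hm, Measure.restrict_congr_set Ioi_ae_eq_Ici.symm]
  have e : ∀ x, Real.toNNReal (Real.exp (-Real.eulerMascheroniConstant) * dickmanRho x) •
      Real.exp (-t * x) =
      Real.exp (-Real.eulerMascheroniConstant) * (dickmanRho x * Real.exp (-t * x)) := by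
    intro x
    rw [NNReal.smul_def, Real.coe_toNNReal _
      (mul_nonneg (Real.exp_pos _).le (dickmanRho_pos x).le), smul_eq_mul, mul_assoc]
  simp_rw [e]
  rw [integral_const_mul]
  change _ * laplaceRho t = _
  rw [laplaceRho_eq ht, ← mul_assoc, ← Real.exp_add]
  simp

lemma ae_nonneg_dickmanMeasure : ∀ᵐ x ∂dickmanMeasure, 0 ≤ x :=
  (withDensity_absolutelyContinuous _ _).ae_le (ae_restrict_mem measurableSet_Ici)

/-! ### The continuity theorem for Laplace transforms -/

section Laplace

variable {ι : Type*} {l : Filter ι} {μ : ι → Measure ℝ} {ν : Measure ℝ}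
  [∀ i, IsProbabilityMeasure (μ i)] [IsProbabilityMeasure ν]

lemma exp_neg_mul_mem_Icc {ε x : ℝ} (hε : 0 ≤ ε) (hx : 0 ≤ x) :
    Real.exp (-ε * x) ∈ Set.Icc (0 : ℝ) 1 :=
  ⟨(Real.exp_pos _).le, Real.exp_le_one_iff.mpr (by nlinarith)⟩

lemma integrable_exp_neg_mul (hν : ∀ᵐ x ∂ν, 0 ≤ x) {t : ℝ} (ht : 0 ≤ t) :
    Integrable (fun x => Real.exp (-t * x)) ν := by
  refine Integrable.of_bound (Measurable.aestronglyMeasurable (by fun_prop)) 1 ?_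
  filter_upwards [hν] with x hx
  rw [Real.norm_of_nonneg (Real.exp_pos _).le]
  exact (exp_neg_mul_mem_Icc ht hx).2

/-- The k-th power of e^(-εx) integrates to the Laplace transform at kε. -/
lemma tendsto_integral_polynomial_exp (hμ : ∀ i, ∀ᵐ x ∂(μ i), 0 ≤ x) (hν : ∀ᵐ x ∂ν, 0 ≤ x)
    (h : ∀ t : ℝ, 0 ≤ t →
      Tendsto (fun i => ∫ x, Real.exp (-t * x) ∂(μ i)) l (𝓝 (∫ x, Real.exp (-t * x) ∂ν)))
    {ε : ℝ} (hε : 0 ≤ ε) (p : Polynomial ℝ) :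
    Tendsto (fun i => ∫ x, p.eval (Real.exp (-ε * x)) ∂(μ i)) l
      (𝓝 (∫ x, p.eval (Real.exp (-ε * x)) ∂ν)) := by
  have key : ∀ (κ : Measure ℝ) [IsProbabilityMeasure κ], (∀ᵐ x ∂κ, 0 ≤ x) →
      ∫ x, p.eval (Real.exp (-ε * x)) ∂κ =
        ∑ k ∈ Finset.range (p.natDegree + 1),
          p.coeff k * ∫ x, Real.exp (-(k * ε) * x) ∂κ := by
    intro κ _ hκ
    simp_rw [Polynomial.eval_eq_sum_range]
    rw [integral_finsetSum]
    · refine Finset.sum_congr rfl fun k _ => ?_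
      rw [integral_const_mul]
      congr 2
      funext x
      rw [← Real.exp_nat_mul]
      ring_nf
    · intro k _
      refine Integrable.const_mul ?_ _
      refine (integrable_exp_neg_mul hκ (by positivity : 0 ≤ k * ε)).congr (.of_forall fun x => ?_)
      simp only
      rw [← Real.exp_nat_mul]
      ring_nf
  rw [key ν hν]
  simp_rw [fun i => key (μ i) (hμ i)]
  exact tendsto_finsetSum _ fun k _ => (h (k * ε) (by positivity)).const_mul _

lemma integrable_comp_exp_neg_mul (hν : ∀ᵐ x ∂ν, 0 ≤ x) {ε : ℝ} (hε : 0 ≤ ε) {h : ℝ → ℝ}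
    (hc : ContinuousOn h (Set.Icc 0 1)) : Integrable (fun x => h (Real.exp (-ε * x))) ν := by
  obtain ⟨C, hC⟩ := isCompact_Icc.exists_bound_of_continuousOn hc
  -- `h` is continuous only on [0, 1]; clamping the argument gives a continuous function that agrees
  -- almost everywhere.
  have hm : Continuous (fun x : ℝ => h (max 0 (min 1 (Real.exp (-ε * x))))) :=
    hc.comp_continuous (by fun_prop) fun x =>
      ⟨le_max_left _ _, max_le zero_le_one (min_le_left _ _)⟩
  have hae : (fun x : ℝ => h (max 0 (min 1 (Real.exp (-ε * x))))) =ᵐ[ν]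
      fun x => h (Real.exp (-ε * x)) := by
    filter_upwards [hν] with x hx
    have := exp_neg_mul_mem_Icc hε hx
    rw [min_eq_right this.2, max_eq_right this.1]
  refine Integrable.of_bound (hm.aestronglyMeasurable.congr hae) C ?_
  filter_upwards [hν] with x hx
  exact hC _ (exp_neg_mul_mem_Icc hε hx)

lemma tendsto_integral_comp_exp (hμ : ∀ i, ∀ᵐ x ∂(μ i), 0 ≤ x) (hν : ∀ᵐ x ∂ν, 0 ≤ x)
    (h : ∀ t : ℝ, 0 ≤ t →
      Tendsto (fun i => ∫ x, Real.exp (-t * x) ∂(μ i)) l (𝓝 (∫ x, Real.exp (-t * x) ∂ν)))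
    {ε : ℝ} (hε : 0 ≤ ε) {g : ℝ → ℝ} (hg : ContinuousOn g (Set.Icc 0 1)) :
    Tendsto (fun i => ∫ x, g (Real.exp (-ε * x)) ∂(μ i)) l
      (𝓝 (∫ x, g (Real.exp (-ε * x)) ∂ν)) := by
  rw [Metric.tendsto_nhds]
  intro δ hδ
  obtain ⟨p, hp⟩ := exists_polynomial_near_of_continuousOn 0 1 g hg (δ / 3) (by positivity)
  have key : ∀ (κ : Measure ℝ) [IsProbabilityMeasure κ], (∀ᵐ x ∂κ, 0 ≤ x) →
      |∫ x, p.eval (Real.exp (-ε * x)) ∂κ - ∫ x, g (Real.exp (-ε * x)) ∂κ| ≤ δ / 3 := by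
    intro κ _ hκ
    rw [← integral_sub (integrable_comp_exp_neg_mul hκ hε (h := fun z => p.eval z) (by fun_prop))
      (integrable_comp_exp_neg_mul hκ hε hg), ← Real.norm_eq_abs]
    refine (norm_integral_le_of_norm_le_const (C := δ / 3) ?_).trans (by simp)
    filter_upwards [hκ] with x hx
    exact (hp _ (exp_neg_mul_mem_Icc hε hx)).le
  filter_upwards [Metric.tendsto_nhds.mp (tendsto_integral_polynomial_exp hμ hν h hε p) (δ / 3)
    (by positivity)] with i hi
  have h1 := abs_le.mp (key (μ i) (hμ i))
  have h2 := abs_le.mp (key ν hν)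
  rw [Real.dist_eq] at hi ⊢
  have h3 := abs_lt.mp hi
  rw [abs_lt]
  constructor <;> linarith [h1.1, h1.2, h2.1, h2.2, h3.1, h3.2]

/-- Takes the place of tightness: the mass far out is controlled by 1 minus the transform at a small
ε. -/
lemma tendsto_integral_exp_neg_mul_zero (hν : ∀ᵐ x ∂ν, 0 ≤ x) :
    Tendsto (fun ε : ℝ => ∫ x, Real.exp (-ε * x) ∂ν) (𝓝[>] 0) (𝓝 1) := by
  have h := tendsto_integral_filter_of_dominated_convergence (μ := ν) (l := 𝓝[>] (0 : ℝ))
    (F := fun ε x => Real.exp (-ε * x)) (f := fun _ => 1) (fun _ => 1)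
    (.of_forall fun ε => Measurable.aestronglyMeasurable (by fun_prop)) ?_ (by simp) ?_
  · simpa using h
  · filter_upwards [self_mem_nhdsWithin] with ε hε
    filter_upwards [hν] with x hx
    rw [Real.norm_of_nonneg (Real.exp_pos _).le]
    exact (exp_neg_mul_mem_Icc (le_of_lt hε) hx).2
  · refine .of_forall fun x => ?_
    have hc : Continuous fun ε : ℝ => Real.exp (-ε * x) := by fun_prop
    simpa using (hc.tendsto 0).mono_left nhdsWithin_le_nhds

/-- Probability measures on `[0, ∞)` whose Laplace transforms converge to that of a probability
measure converge weakly. -/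
theorem tendsto_integral_of_tendsto_laplace (hμ : ∀ i, ∀ᵐ x ∂(μ i), 0 ≤ x)
    (hν : ∀ᵐ x ∂ν, 0 ≤ x)
    (h : ∀ t : ℝ, 0 ≤ t →
      Tendsto (fun i => ∫ x, Real.exp (-t * x) ∂(μ i)) l (𝓝 (∫ x, Real.exp (-t * x) ∂ν)))
    (f : BoundedContinuousFunction ℝ ℝ) :
    Tendsto (fun i => ∫ x, f x ∂(μ i)) l (𝓝 (∫ x, f x ∂ν)) := by
  rw [Metric.tendsto_nhds]
  intro δ hδ
  set C := ‖f‖ + 1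
  have hC : 0 < C := by positivity
  have hsmall : ∀ᶠ ε in 𝓝[>] (0 : ℝ), 1 - δ / (4 * C) < ∫ x, Real.exp (-ε * x) ∂ν :=
    (tendsto_integral_exp_neg_mul_zero hν).eventually_const_lt (by
      have : 0 < δ / (4 * C) := by positivity
      linarith)
  obtain ⟨ε, hεν, hε⟩ := (hsmall.and self_mem_nhdsWithin).exists
  have hε : 0 < ε := hε
  -- In the variable z = e^(-εx), infinity becomes z = 0, where `f` need not have a limit. The extra
  -- factor z makes `g` continuous there and costs at most C(1 - ∫ e^(-εx)), which is small for ν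
  -- and hence eventually for μ i.
  let g : ℝ → ℝ := fun z => z * f (-Real.log z / ε)
  have hg : ContinuousOn g (Set.Icc 0 1) := by
    intro z hz
    rcases hz.1.eq_or_lt with rfl | hz0
    · refine ContinuousAt.continuousWithinAt ?_
      have h0 : g 0 = 0 := by simp [g]
      rw [ContinuousAt, h0]
      refine squeeze_zero_norm (a := fun z => |z| * ‖f‖) (fun z => ?_) ?_
      · rw [norm_mul, Real.norm_eq_abs]
        gcongr
        exact f.norm_coe_le_norm _
      · have : Continuous fun z : ℝ => |z| * ‖f‖ := by fun_prop
        simpa using this.tendsto 0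
    · refine ContinuousAt.continuousWithinAt ?_
      refine continuousAt_id.mul (f.continuous.continuousAt.comp ?_)
      exact ((Real.continuousAt_log hz0.ne').neg).div_const ε
  have hgexp : ∀ x, g (Real.exp (-ε * x)) = Real.exp (-ε * x) * f x := by
    intro x
    simp only [g, Real.log_exp]
    congr 2
    field_simp
  have key : ∀ (κ : Measure ℝ) [IsProbabilityMeasure κ], (∀ᵐ x ∂κ, 0 ≤ x) →
      |∫ x, f x ∂κ - ∫ x, g (Real.exp (-ε * x)) ∂κ| ≤
        C * (1 - ∫ x, Real.exp (-ε * x) ∂κ) := by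
    intro κ _ hκ
    have hi := integrable_exp_neg_mul hκ hε.le
    rw [← integral_sub (f.integrable κ) (integrable_comp_exp_neg_mul hκ hε.le hg),
      ← Real.norm_eq_abs]
    have e : ∫ x, C * (1 - Real.exp (-ε * x)) ∂κ = C * (1 - ∫ x, Real.exp (-ε * x) ∂κ) := by
      rw [integral_const_mul, integral_sub (integrable_const _) hi]
      simp
    rw [← e]
    refine norm_integral_le_of_norm_le (((integrable_const _).sub hi).const_mul C) ?_
    filter_upwards [hκ] with x hx
    have h1 := (exp_neg_mul_mem_Icc hε.le hx).2
    rw [hgexp, show f x - Real.exp (-ε * x) * f x = f x * (1 - Real.exp (-ε * x)) by ring,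
      norm_mul, Real.norm_of_nonneg (sub_nonneg.mpr h1)]
    gcongr
    exact (f.norm_coe_le_norm x).trans (by simp [C])
  have hCδ : C * (δ / (4 * C)) = δ / 4 := by field_simp
  filter_upwards [Metric.tendsto_nhds.mp (tendsto_integral_comp_exp hμ hν h hε.le hg) (δ / 4)
    (by positivity), (h ε hε.le).eventually_const_lt hεν] with i hi hi2
  have h1 := abs_le.mp (key (μ i) (hμ i))
  have h2 := abs_le.mp (key ν hν)
  have b1 : C * (1 - ∫ x, Real.exp (-ε * x) ∂(μ i)) ≤ δ / 4 := by
    rw [← hCδ]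
    gcongr
    linarith
  have b2 : C * (1 - ∫ x, Real.exp (-ε * x) ∂ν) ≤ δ / 4 := by
    rw [← hCδ]
    gcongr
    linarith
  rw [Real.dist_eq] at hi ⊢
  have h3 := abs_lt.mp hi
  rw [abs_lt]
  constructor <;> linarith [h1.1, h1.2, h2.1, h2.2, h3.1, h3.2]

end Laplace

/-! ### Mertens' first theorem -/

/-- From log n ≤ 2√n. This series bounds every second-order error over the primes below. -/
lemma summable_log_div_sq : Summable fun n : ℕ => Real.log n / (n : ℝ) ^ 2 := by
  have h : Summable fun n : ℕ => 2 * (n : ℝ) ^ (-(3 / 2) : ℝ) :=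
    (Real.summable_nat_rpow.mpr (by norm_num)).mul_left 2
  refine h.of_nonneg_of_le (fun n => div_nonneg (Real.log_natCast_nonneg n) (by positivity))
    fun n => ?_
  rcases n.eq_zero_or_pos with rfl | hn
  · simp only [CharP.cast_eq_zero, Real.log_zero, zero_div]
    positivity
  have hn' : (0 : ℝ) < n := by exact_mod_cast hn
  have h1 := Real.log_le_rpow_div hn'.le (ε := 1 / 2) (by norm_num)
  rw [div_le_iff₀ (by positivity)]
  calc Real.log n ≤ 2 * (n : ℝ) ^ (1 / 2 : ℝ) := by linarith
    _ = 2 * (n : ℝ) ^ (-(3 / 2) : ℝ) * (n : ℝ) ^ 2 := by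
      rw [mul_assoc, ← Real.rpow_natCast, ← Real.rpow_add hn']
      norm_num

/-- The constant `∑ log n / n²`. -/
noncomputable def logSqConst : ℝ := ∑' n : ℕ, Real.log n / (n : ℝ) ^ 2

lemma sum_log_div_sq_le (s : Finset ℕ) : ∑ n ∈ s, Real.log n / (n : ℝ) ^ 2 ≤ logSqConst :=
  summable_log_div_sq.sum_le_tsum s fun n _ =>
    div_nonneg (Real.log_natCast_nonneg n) (by positivity)

lemma logSqConst_nonneg : 0 ≤ logSqConst := by simpa using sum_log_div_sq_le ∅

lemma log_factorial_eq_sum (n : ℕ) :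
    Real.log (n.factorial) =
      ∑ p ∈ n.primesLE, (n.factorial.factorization p : ℝ) * Real.log p := by
  rw [Real.log_nat_eq_sum_factorization]
  refine Finsupp.sum_of_support_subset _ (fun p hp => ?_) _ (by simp)
  rw [Nat.support_factorization, Nat.mem_primeFactors] at hp
  exact Nat.mem_primesLE.mpr ⟨(Nat.Prime.dvd_factorial hp.1).mp hp.2.1, hp.1⟩

lemma div_sub_one_le_factorization_factorial {n p : ℕ} (hp : p.Prime) :
    (n : ℝ) / p - 1 ≤ n.factorial.factorization p := by
  have h1 : n / p ≤ n.factorial.factorization p := by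
    rw [Nat.factorization_factorial hp (show Nat.log p n < Nat.log p n + 2 by omega)]
    calc n / p = n / p ^ 1 := by rw [pow_one]
      _ ≤ _ := Finset.single_le_sum (f := fun i => n / p ^ i) (fun _ _ => Nat.zero_le _)
        (Finset.mem_Ico.mpr ⟨le_rfl, by omega⟩)
  have h2 : (n : ℝ) / p < (n / p : ℕ) + 1 := by
    rw [← Nat.floor_div_eq_div (K := ℝ)]
    exact Nat.lt_floor_add_one _
  have h3 : ((n / p : ℕ) : ℝ) ≤ n.factorial.factorization p := by exact_mod_cast h1
  linarith

/-- Legendre's formula: (p - 1) v_p(n!) is n minus the digit sum of n in base p. -/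
lemma factorization_factorial_le {n p : ℕ} (hp : p.Prime) :
    (n.factorial.factorization p : ℝ) ≤ n / (p - 1) := by
  have := Fact.mk hp
  have h := sub_one_mul_padicValNat_factorial (p := p) n
  rw [← Nat.factorization_def _ hp] at h
  have h1 : (p - 1) * n.factorial.factorization p ≤ n := by omega
  have h2 : (1 : ℝ) < p := by exact_mod_cast hp.one_lt
  rw [le_div_iff₀ (by linarith), mul_comm]
  have h3 : (((p - 1) * n.factorial.factorization p : ℕ) : ℝ) ≤ n := by exact_mod_cast h1
  rwa [Nat.cast_mul, Nat.cast_sub hp.one_lt.le, Nat.cast_one] at h3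

/-- Compare log n! ≤ n log n with its prime factorization; rounding n/p down costs at most θ(n) ≤ n
log 4. -/
lemma sum_log_div_le {n : ℕ} (hn : 0 < n) :
    ∑ p ∈ n.primesLE, Real.log p / p ≤ Real.log n + Real.log 4 := by
  have hn' : (0 : ℝ) < n := by exact_mod_cast hn
  have h1 : n * ∑ p ∈ n.primesLE, Real.log p / p - Chebyshev.theta n ≤
      Real.log (n.factorial) := by
    rw [log_factorial_eq_sum, Chebyshev.theta_eq_sum_primesLE_log, Finset.mul_sum,
      ← Finset.sum_sub_distrib]
    refine Finset.sum_le_sum fun p hp => ?_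
    have h := div_sub_one_le_factorization_factorial (n := n) (Nat.prime_of_mem_primesLE hp)
    calc n * (Real.log p / p) - Real.log p = (n / p - 1) * Real.log p := by ring
      _ ≤ _ := mul_le_mul_of_nonneg_right h (Real.log_natCast_nonneg p)
  have h2 : Real.log (n.factorial) ≤ n * Real.log n := by
    rw [← Real.log_pow]
    exact Real.log_le_log (by positivity) (by exact_mod_cast Nat.factorial_le_pow n)
  have h3 := Chebyshev.theta_le_log4_mul_x hn'.le
  have h4 : n * ∑ p ∈ n.primesLE, Real.log p / p ≤ n * (Real.log n + Real.log 4) := by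
    linarith
  exact le_of_mul_le_mul_left h4 hn'

/-- Stirling bounds log n! below, and higher prime powers only turn 1/p into 1/(p-1) ≤ 1/p + 2/p².
-/
lemma le_sum_log_div {n : ℕ} (hn : 0 < n) :
    Real.log n - 1 - 2 * logSqConst ≤ ∑ p ∈ n.primesLE, Real.log p / p := by
  have hn' : (0 : ℝ) < n := by exact_mod_cast hn
  have h1 : Real.log (n.factorial) ≤
      n * (∑ p ∈ n.primesLE, Real.log p / p + 2 * logSqConst) := by
    refine le_trans ?_ (mul_le_mul_of_nonneg_left (add_le_add_right
      (mul_le_mul_of_nonneg_left (sum_log_div_sq_le n.primesLE) zero_le_two) _) hn'.le)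
    rw [log_factorial_eq_sum, Finset.mul_sum, ← Finset.sum_add_distrib, Finset.mul_sum]
    refine Finset.sum_le_sum fun p hp => ?_
    have hpp := Nat.prime_of_mem_primesLE hp
    have hp2 : (2 : ℝ) ≤ p := by exact_mod_cast hpp.two_le
    have hlog := Real.log_natCast_nonneg p
    have h : (1 : ℝ) / (p - 1) ≤ 1 / p + 2 / p ^ 2 := by
      rw [div_add_div _ _ (by positivity) (by positivity),
        div_le_div_iff₀ (by linarith) (by positivity)]
      nlinarith
    calc (n.factorial.factorization p : ℝ) * Real.log p ≤ n / (p - 1) * Real.log p := by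
          gcongr
          exact factorization_factorial_le hpp
      _ = n * (Real.log p * (1 / (p - 1))) := by ring
      _ ≤ n * (Real.log p * (1 / p + 2 / p ^ 2)) := by gcongr
      _ = _ := by ring
  have h2 : n * Real.log n - n ≤ Real.log (n.factorial) := by
    have h3 := Stirling.le_log_factorial_stirling hn.ne'
    have h4 := Real.log_natCast_nonneg n
    have h5 : 0 ≤ Real.log (2 * Real.pi) := Real.log_nonneg (by linarith [Real.pi_gt_three])
    linarith
  have h3 : n * (Real.log n - 1 - 2 * logSqConst) ≤ n * ∑ p ∈ n.primesLE, Real.log p / p := by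
    linarith
  exact le_of_mul_le_mul_left h3 hn'

/-- Mertens' first theorem, with `log n` replaced by the harmonic sum. -/
theorem exists_abs_sum_log_div_sub_inv_le :
    ∃ K : ℝ, ∀ n : ℕ, |∑ i ∈ Finset.range n,
      ((if i.Prime then Real.log i / i else 0) - (i : ℝ)⁻¹)| ≤ K := by
  refine ⟨Real.log 4 + 2 + 2 * logSqConst, fun n => ?_⟩
  have hK := logSqConst_nonneg
  have h4 : 0 ≤ Real.log 4 := Real.log_nonneg (by norm_num)
  rcases n with _ | n
  · simp only [Finset.range_zero, Finset.sum_empty, abs_zero]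
    positivity
  rcases n.eq_zero_or_pos with rfl | hn
  · simp [Nat.not_prime_zero]
    positivity
  have hn' : (0 : ℝ) < n := by exact_mod_cast hn
  have e : ∑ i ∈ Finset.range (n + 1), (i : ℝ)⁻¹ = harmonic n := by
    rw [Finset.sum_range_succ', harmonic]
    simp
  rw [Finset.sum_sub_distrib, ← Finset.sum_filter, ← Nat.primesLE_eq_filter_range, e]
  have h1 := sum_log_div_le hn
  have h2 := le_sum_log_div hn
  have h3 := harmonic_le_one_add_log n
  have h5 := log_add_one_le_harmonic n
  have h6 : Real.log n ≤ Real.log (n + 1 : ℕ) := by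
    refine Real.log_le_log hn' ?_
    push_cast
    linarith
  rw [abs_le]
  constructor <;> linarith

/-! ### The logarithm of the `N`-th prime -/

lemma tendsto_natCast_nth_prime :
    Tendsto (fun N : ℕ => ((Nat.nth Nat.Prime N : ℕ) : ℝ)) atTop atTop :=
  tendsto_natCast_atTop_atTop.comp (Nat.nth_strictMono Nat.infinite_setOfPred_prime).tendsto_atTop

lemma tendsto_log_natCast : Tendsto (fun N : ℕ => Real.log N) atTop atTop :=
  Real.tendsto_log_atTop.comp tendsto_natCast_atTop_atTop

lemma tendsto_log_log_div_log :
    Tendsto (fun x : ℝ => Real.log (Real.log x) / Real.log x) atTop (𝓝 0) :=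
  (Real.isLittleO_log_id_atTop.tendsto_div_nhds_zero).comp Real.tendsto_log_atTop

lemma eventually_le_primeCounting :
    ∀ᶠ n : ℕ in atTop, (n : ℝ) ≤ 2 * Nat.primeCounting n * Real.log n := by
  have h1 : ∀ᶠ x : ℝ in atTop, Real.log (x + 1) ≤ 1 / 10 * (x + 1) := by
    have h := (Real.isLittleO_log_id_atTop.bound (show (0 : ℝ) < 1 / 10 by norm_num)).and
      (eventually_ge_atTop 1)
    filter_upwards [(tendsto_atTop_add_const_right atTop (1 : ℝ) tendsto_id).eventually h]
      with x hx
    have h2 := hx.1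
    simp only [id] at h2 hx
    rw [Real.norm_of_nonneg (Real.log_nonneg hx.2), Real.norm_of_nonneg (by linarith)] at h2
    exact h2
  filter_upwards [tendsto_natCast_atTop_atTop.eventually h1, eventually_ge_atTop 2] with n hn hn2
  have hn2' : (2 : ℝ) ≤ n := by exact_mod_cast hn2
  have h := Chebyshev.pi_ge n
  have hlog : 0 < Real.log n := Real.log_pos (by linarith)
  rw [div_le_iff₀ hlog] at h
  have := Real.log_two_gt_d9
  nlinarith

/-- With x = `Nat.nth Nat.Prime N` one has π(x) = N + 1, so N + 1 ≤ x ≤ 2(N + 1) log x by Chebyshev.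
After taking logarithms, the constant and log log x are negligible. -/
lemma tendsto_log_nth_prime_div_log :
    Tendsto (fun N : ℕ => Real.log (Nat.nth Nat.Prime N) / Real.log N) atTop (𝓝 1) := by
  have hx := tendsto_natCast_nth_prime
  have hlogx := Real.tendsto_log_atTop.comp hx
  have h1 : Tendsto (fun N : ℕ => Real.log (N + 1) / Real.log (Nat.nth Nat.Prime N)) atTop
      (𝓝 1) := by
    have hlow : Tendsto (fun N : ℕ => 1 - Real.log 2 / Real.log (Nat.nth Nat.Prime N) -
        Real.log (Real.log (Nat.nth Nat.Prime N)) / Real.log (Nat.nth Nat.Prime N)) atTop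
        (𝓝 1) := by
      simpa using ((tendsto_const_nhds (x := Real.log 2)).div_atTop hlogx).const_sub 1 |>.sub
        (tendsto_log_log_div_log.comp hx)
    refine tendsto_of_tendsto_of_tendsto_of_le_of_le' hlow tendsto_const_nhds ?_ ?_
    · filter_upwards [(Nat.nth_strictMono Nat.infinite_setOfPred_prime).tendsto_atTop.eventually
        eventually_le_primeCounting, hlogx.eventually_gt_atTop 0,
        hx.eventually_gt_atTop 0] with N hN hpos hxpos
      simp only [Function.comp_apply] at hpos
      have hπ : Nat.primeCounting (Nat.nth Nat.Prime N) = N + 1 := by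
        rw [Nat.primeCounting, Nat.primeCounting', Nat.count_succ,
          if_pos (Nat.prime_nth_prime N), Nat.count_nth_of_infinite Nat.infinite_setOfPred_prime]
      rw [hπ] at hN
      push_cast at hN
      have h := Real.log_le_log hxpos hN
      rw [Real.log_mul (by positivity) hpos.ne', Real.log_mul two_ne_zero (by positivity)] at h
      rw [le_div_iff₀ hpos]
      field_simp
      linarith
    · filter_upwards [hlogx.eventually_gt_atTop 0] with N hpos
      simp only [Function.comp_apply] at hpos
      rw [div_le_one hpos]
      refine Real.log_le_log (by positivity) ?_
      have := Nat.add_two_le_nth_prime N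
      exact_mod_cast (by omega : N + 1 ≤ Nat.nth Nat.Prime N)
  have h2 : Tendsto (fun N : ℕ => Real.log (N + 1) / Real.log N) atTop (𝓝 1) := by
    have h := (Real.tendsto_log_nat_add_one_sub_log.div_atTop tendsto_log_natCast).const_add 1
    rw [add_zero] at h
    refine h.congr' ?_
    filter_upwards [tendsto_log_natCast.eventually_gt_atTop 0] with N hN
    field_simp
    ring
  have h3 := h2.div h1 one_ne_zero
  rw [div_one] at h3
  refine h3.congr' ?_
  filter_upwards [eventually_ge_atTop 1] with N hN
  have hN' : (1 : ℝ) ≤ N := by exact_mod_cast hN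
  have : Real.log (N + 1) ≠ 0 := (Real.log_pos (by linarith)).ne'
  simp only [Pi.div_apply]
  field_simp

/-! ### Sums of smooth functions of `log p` over the primes -/

lemma sum_range_mul_eq_by_parts (d f : ℕ → ℝ) (n : ℕ) :
    ∑ i ∈ Finset.range n, d i * f i =
      ∑ i ∈ Finset.range n, (∑ j ∈ Finset.range (i + 1), d j) * (f i - f (i + 1)) +
        (∑ j ∈ Finset.range n, d j) * f n := by
  induction n with
  | zero => simp
  | succ n ih =>
    rw [Finset.sum_range_succ, ih, Finset.sum_range_succ _ n, Finset.sum_range_succ d n]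
    ring

/-- Summation by parts: the nonnegative differences of `f` telescope to `f 0`. -/
lemma abs_sum_range_mul_le {d f : ℕ → ℝ} {K : ℝ}
    (hd : ∀ n, |∑ i ∈ Finset.range n, d i| ≤ K) (hf : Antitone f) (hf0 : ∀ n, 0 ≤ f n) (n : ℕ) :
    |∑ i ∈ Finset.range n, d i * f i| ≤ K * f 0 := by
  rw [sum_range_mul_eq_by_parts]
  calc _ ≤ ∑ i ∈ Finset.range n, K * (f i - f (i + 1)) + K * f n := by
        refine (abs_add_le _ _).trans (add_le_add ((Finset.abs_sum_le_sum_abs _ _).trans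
          (Finset.sum_le_sum fun i _ => ?_)) ?_)
        · rw [abs_mul, abs_of_nonneg (sub_nonneg.mpr (hf i.le_succ))]
          exact mul_le_mul_of_nonneg_right (hd _) (sub_nonneg.mpr (hf i.le_succ))
        · rw [abs_mul, abs_of_nonneg (hf0 n)]
          exact mul_le_mul_of_nonneg_right (hd _) (hf0 n)
    _ = K * f 0 := by
        rw [← Finset.mul_sum, Finset.sum_range_sub']
        ring

/-- Integral test for a decreasing function; the term i = 0 vanishes because `0⁻¹ = 0`. -/
lemma abs_sum_inv_mul_sub_integral_le {f : ℝ → ℝ} (hf : AntitoneOn f (Set.Ici 1))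
    (hf0 : ∀ x, 0 ≤ f x) {n : ℕ} (hn : 1 ≤ n) :
    |∑ i ∈ Finset.range n, (i : ℝ)⁻¹ * f i - ∫ x in (1 : ℝ)..n, x⁻¹ * f x| ≤ f 1 := by
  have hanti : AntitoneOn (fun x : ℝ => x⁻¹ * f x) (Set.Icc (1 : ℕ) n) := by
    intro x hx y hy hxy
    have hx1 : 1 ≤ x := by simpa using hx.1
    have hy1 : 1 ≤ y := by simpa using hy.1
    exact mul_le_mul (inv_anti₀ (by linarith) hxy) (hf hx1 hy1 hxy) (hf0 y) (by positivity)
  have h1 := hanti.integral_le_sum_Ico hn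
  have h2 := hanti.sum_le_integral_Ico hn
  rw [Nat.cast_one] at h1 h2
  have e1 : ∑ i ∈ Finset.range n, (i : ℝ)⁻¹ * f i = ∑ i ∈ Finset.Ico 1 n, (i : ℝ)⁻¹ * f i := by
    rw [Finset.range_eq_Ico, Finset.sum_eq_sum_Ico_succ_bot (by omega)]
    simp
  have e2 : ∑ i ∈ Finset.Ico 1 n, (i : ℝ)⁻¹ * f i + (n : ℝ)⁻¹ * f n =
      f 1 + ∑ i ∈ Finset.Ico 1 n, ((i + 1 : ℕ) : ℝ)⁻¹ * f ((i + 1 : ℕ) : ℝ) := by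
    rw [Finset.sum_Ico_add' (fun i : ℕ => (i : ℝ)⁻¹ * f i), ← Finset.sum_Ico_succ_top hn,
      Finset.sum_eq_sum_Ico_succ_bot (by omega)]
    simp
  have h3 : 0 ≤ (n : ℝ)⁻¹ * f n := mul_nonneg (by positivity) (hf0 n)
  rw [e1, abs_le]
  constructor <;> linarith [hf0 1]

/-- The function `u ↦ (1 - e^{-tu}) / u`, extended continuously to `u = 0`. -/
noncomputable def expQuotient (t u : ℝ) : ℝ := ∫ v in (0 : ℝ)..t, Real.exp (-u * v)

lemma mul_expQuotient (t u : ℝ) : u * expQuotient t u = 1 - Real.exp (-t * u) := by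
  have hd : ∀ v : ℝ, HasDerivAt (fun v => -Real.exp (-u * v)) (u * Real.exp (-u * v)) v := by
    intro v
    have h := (((hasDerivAt_id v).const_mul (-u)).exp).neg
    convert! h using 1
    simp only [id]
    ring
  rw [expQuotient, ← intervalIntegral.integral_const_mul,
    intervalIntegral.integral_eq_sub_of_hasDerivAt (fun v _ => hd v)
      (Continuous.intervalIntegrable (by fun_prop) _ _)]
  simp only [mul_zero, Real.exp_zero]
  ring_nf

lemma expQuotient_zero (t : ℝ) : expQuotient t 0 = t := by simp [expQuotient]

lemma expQuotient_nonneg {t : ℝ} (ht : 0 ≤ t) (u : ℝ) : 0 ≤ expQuotient t u :=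
  intervalIntegral.integral_nonneg ht fun _ _ => (Real.exp_pos _).le

lemma antitone_expQuotient {t : ℝ} (ht : 0 ≤ t) : Antitone (expQuotient t) := by
  intro u v huv
  refine intervalIntegral.integral_mono_on ht (Continuous.intervalIntegrable (by fun_prop) _ _)
    (Continuous.intervalIntegrable (by fun_prop) _ _) fun w hw => ?_
  exact Real.exp_le_exp.mpr (by nlinarith [hw.1])

lemma continuous_expQuotient (t : ℝ) : Continuous (expQuotient t) :=
  intervalIntegral.continuous_parametric_intervalIntegral_of_continuous' (by fun_prop) _ _

lemma integral_expQuotient (t : ℝ) : ∫ u in (0 : ℝ)..1, expQuotient t u = laplaceExponent t := by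
  refine intervalIntegral.integral_congr_ae (.of_forall fun u hu => ?_)
  rw [Set.uIoc_of_le zero_le_one] at hu
  rw [← mul_expQuotient, mul_div_cancel_left₀ _ hu.1.ne']

lemma integral_inv_mul_comp_log_div {g : ℝ → ℝ} (hg : Continuous g) {L X : ℝ}
    (hX : 1 ≤ X) :
    ∫ x in (1 : ℝ)..X, x⁻¹ * (g (Real.log x / L) / L) =
      ∫ u in (0 : ℝ)..(Real.log X / L), g u := by
  have hpos : ∀ x ∈ Set.uIcc 1 X, 0 < x := by
    intro x hx
    rw [Set.uIcc_of_le hX] at hx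
    linarith [hx.1]
  have hd : ∀ x ∈ Set.uIcc 1 X, HasDerivAt (fun x => ∫ u in (0 : ℝ)..(Real.log x / L), g u)
      (x⁻¹ * (g (Real.log x / L) / L)) x := by
    intro x hx
    have h1 : HasDerivAt (fun y => ∫ u in (0 : ℝ)..y, g u) (g (Real.log x / L))
        (Real.log x / L) :=
      intervalIntegral.integral_hasDerivAt_right (hg.intervalIntegrable _ _)
        (hg.stronglyMeasurableAtFilter _ _) hg.continuousAt
    have h2 := h1.comp x ((Real.hasDerivAt_log (hpos x hx).ne').div_const L)
    convert! h2 using 1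
    ring
  rw [intervalIntegral.integral_eq_sub_of_hasDerivAt hd]
  · simp
  · refine ContinuousOn.intervalIntegrable fun x hx => ContinuousAt.continuousWithinAt ?_
    have hx0 := (hpos x hx).ne'
    exact (continuousAt_inv₀ hx0).mul ((hg.continuousAt.comp
      ((Real.continuousAt_log hx0).div_const L)).div_const L)

/-- The sum over the first `N` primes approximating the Laplace exponent. -/
lemma tendsto_sum_primesBelow {t : ℝ} (ht : 0 ≤ t) :
    Tendsto (fun N : ℕ => ∑ p ∈ (Nat.nth Nat.Prime N).primesBelow,
      (p : ℝ)⁻¹ * (1 - Real.exp (-t * (Real.log p / Real.log N)))) atTop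
      (𝓝 (laplaceExponent t)) := by
  obtain ⟨K, hK⟩ := exists_abs_sum_log_div_sub_inv_le
  have hprim : Continuous fun y => ∫ u in (0 : ℝ)..y, expQuotient t u :=
    intervalIntegral.continuous_primitive
      (fun a b => (continuous_expQuotient t).intervalIntegrable a b) 0
  have hmain : Tendsto (fun N : ℕ =>
      ∫ u in (0 : ℝ)..(Real.log (Nat.nth Nat.Prime N) / Real.log N), expQuotient t u) atTop
      (𝓝 (laplaceExponent t)) := by
    rw [← integral_expQuotient]
    exact (hprim.tendsto 1).comp tendsto_log_nth_prime_div_log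
  -- Passing from primes to all integers costs K f(0) by Mertens, passing from the sum to the
  -- integral costs f(1), and both values of `f` are t / log N.
  have herr : Tendsto (fun N : ℕ => (K + 1) * (t / Real.log N)) atTop (𝓝 0) := by
    simpa using (tendsto_const_nhds.div_atTop tendsto_log_natCast).const_mul (K + 1)
  refine (tendsto_iff_of_dist (tendsto_of_tendsto_of_tendsto_of_le_of_le'
    tendsto_const_nhds herr (.of_forall fun _ => dist_nonneg) ?_)).mp hmain
  filter_upwards [tendsto_log_natCast.eventually_gt_atTop 0] with N hL
  set L := Real.log N
  set x := Nat.nth Nat.Prime N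
  have hx : 1 ≤ x := (Nat.prime_nth_prime N).one_lt.le
  -- Chosen so that (1 - e^(-t log p / L))/p = ((log p)/p) f(p), with `f` decreasing and small.
  let f : ℝ → ℝ := fun y => expQuotient t (Real.log y / L) / L
  have hf0 : ∀ y, 0 ≤ f y := fun y => div_nonneg (expQuotient_nonneg ht _) hL.le
  have hf : AntitoneOn f (Set.Ici 1) := by
    intro a ha b _ hab
    have ha : (1 : ℝ) ≤ a := ha
    refine div_le_div_of_nonneg_right (antitone_expQuotient ht ?_) hL.le
    exact div_le_div_of_nonneg_right (Real.log_le_log (by linarith) hab) hL.le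
  have hfN : Antitone fun n : ℕ => f n := by
    intro a b hab
    refine div_le_div_of_nonneg_right (antitone_expQuotient ht ?_) hL.le
    refine div_le_div_of_nonneg_right ?_ hL.le
    -- Since `Real.log 0 = 0`, the index 0 does not break monotonicity.
    rcases a.eq_zero_or_pos with rfl | ha
    · simpa using Real.log_natCast_nonneg b
    · exact Real.log_le_log (by exact_mod_cast ha) (by exact_mod_cast hab)
  have hf1 : f 1 = t / L := by simp [f, expQuotient_zero]
  have hfzero : f (0 : ℕ) = t / L := by simp [f, expQuotient_zero]
  have h1 := abs_sum_range_mul_le hK hfN (fun n => hf0 n) x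
  have h2 := abs_sum_inv_mul_sub_integral_le hf hf0 hx
  have hint : ∫ y in (1 : ℝ)..x, y⁻¹ * f y =
      ∫ u in (0 : ℝ)..(Real.log x / L), expQuotient t u :=
    integral_inv_mul_comp_log_div (continuous_expQuotient t) (by exact_mod_cast hx)
  have e : ∑ p ∈ x.primesBelow, (p : ℝ)⁻¹ * (1 - Real.exp (-t * (Real.log p / L))) =
      ∑ i ∈ Finset.range x, (if i.Prime then Real.log i / i else 0) * f i := by
    rw [Nat.primesBelow_eq_filter_range, Finset.sum_filter]
    refine Finset.sum_congr rfl fun i _ => ?_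
    split_ifs
    · rw [← mul_expQuotient]
      simp only [f]
      ring
    · simp
  rw [hfzero] at h1
  rw [hf1, hint] at h2
  simp_rw [sub_mul] at h1
  rw [Finset.sum_sub_distrib, ← e] at h1
  rw [Real.dist_eq, abs_le]
  rw [abs_le] at h1 h2
  constructor <;> linarith [h1.1, h1.2, h2.1, h2.2]

/-! ### Euler products -/

/-- `Nat.nth` counts from 0, so `Nat.nth Nat.Prime N` is p_(N+1), and the primes strictly below it
are exactly p_1, …, p_N. -/
lemma Omega_eq_smoothNumbers (N : ℕ) : Omega N = Nat.smoothNumbers (Nat.nth Nat.Prime N) := by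
  refine (Omega_subset_smoothNumbers N).antisymm fun n hn => ⟨Nat.pos_of_ne_zero hn.1, ?_⟩
  intro j hj hdvd
  have hlt := hn.2 _ ((Nat.mem_primeFactorsList hn.1).mpr ⟨Nat.prime_nth_prime _, hdvd⟩)
  have := (Nat.nth_lt_nth Nat.infinite_setOfPred_prime).mp hlt
  omega

/-- The completely multiplicative function `n ↦ n^{-1-s}`. -/
noncomputable def invPow (s : ℝ) : ℕ →* ℝ where
  toFun n := (n : ℝ)⁻¹ * Real.exp (-s * Real.log n)
  map_one' := by simp
  map_mul' a b := by
    rcases eq_or_ne a 0 with rfl | ha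
    · simp
    rcases eq_or_ne b 0 with rfl | hb
    · simp
    rw [Nat.cast_mul, Real.log_mul (by exact_mod_cast ha) (by exact_mod_cast hb), mul_add,
      Real.exp_add, mul_inv]
    ring

lemma invPow_apply (s : ℝ) (n : ℕ) : invPow s n = (n : ℝ)⁻¹ * Real.exp (-s * Real.log n) := rfl

lemma invPow_zero_apply (n : ℕ) : invPow 0 n = (n : ℝ)⁻¹ := by simp [invPow_apply]

lemma invPow_nonneg (s : ℝ) (n : ℕ) : 0 ≤ invPow s n := by
  rw [invPow_apply]
  positivity

lemma invPow_le {s : ℝ} (hs : 0 ≤ s) (n : ℕ) : invPow s n ≤ (n : ℝ)⁻¹ := by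
  rw [invPow_apply]
  refine mul_le_of_le_one_right (by positivity) (Real.exp_le_one_iff.mpr ?_)
  nlinarith [Real.log_natCast_nonneg n]

lemma inv_prime_le_half {p : ℕ} (hp : p.Prime) : (p : ℝ)⁻¹ ≤ 1 / 2 := by
  rw [one_div]
  exact inv_anti₀ two_pos (by exact_mod_cast hp.two_le)

lemma invPow_prime_le_half {s : ℝ} (hs : 0 ≤ s) {p : ℕ} (hp : p.Prime) : invPow s p ≤ 1 / 2 :=
  (invPow_le hs p).trans (inv_prime_le_half hp)

lemma hasSum_invPow {s : ℝ} (hs : 0 ≤ s) (N : ℕ) :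
    HasSum ((Omega N).indicator (invPow s))
      (∏ p ∈ (Nat.nth Nat.Prime N).primesBelow, (1 - invPow s p)⁻¹) := by
  rw [Omega_eq_smoothNumbers, ← hasSum_subtype_iff_indicator]
  refine (EulerProduct.summable_and_hasSum_smoothNumbers_prod_primesBelow_geometric
    (fun {p} hp => ?_) _).2
  rw [Real.norm_of_nonneg (invPow_nonneg s p)]
  linarith [invPow_prime_le_half hs hp]

lemma one_mem_kFree {k : ℕ} (hk : 2 ≤ k) : 1 ∈ kFree k := by
  refine ⟨one_pos, fun p hp h => ?_⟩
  exact hp.one_lt.ne' ((Nat.pow_eq_one.mp (Nat.dvd_one.mp h)).resolve_right (by omega))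

lemma mul_mem_kFree_iff {k m n : ℕ} (hk : 2 ≤ k) (h : m.Coprime n) :
    m * n ∈ kFree k ↔ m ∈ kFree k ∧ n ∈ kFree k := by
  have hdvd : ∀ p : ℕ, p.Prime → (p ^ k ∣ m * n ↔ p ^ k ∣ m ∨ p ^ k ∣ n) := fun p hp =>
    h.isPrimePow_dvd_mul (hp.isPrimePow.pow (by omega))
  constructor
  · rintro ⟨h0, h1⟩
    have h0 := Nat.pos_iff_ne_zero.mp h0
    exact ⟨⟨Nat.pos_of_ne_zero (left_ne_zero_of_mul h0),
        fun p hp hd => h1 p hp ((hdvd p hp).mpr (.inl hd))⟩,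
      ⟨Nat.pos_of_ne_zero (right_ne_zero_of_mul h0),
        fun p hp hd => h1 p hp ((hdvd p hp).mpr (.inr hd))⟩⟩
  · rintro ⟨⟨h1, h2⟩, ⟨h3, h4⟩⟩
    exact ⟨Nat.mul_pos h1 h3, fun p hp hd => ((hdvd p hp).mp hd).elim (h2 p hp) (h4 p hp)⟩

lemma prime_pow_mem_kFree_iff {k p j : ℕ} (hk : 2 ≤ k) (hp : p.Prime) :
    p ^ j ∈ kFree k ↔ j < k := by
  constructor
  · rintro ⟨-, h⟩
    by_contra! hle
    exact h p hp (pow_dvd_pow p hle)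
  · refine fun hj => ⟨pow_pos hp.pos j, fun q hq hd => ?_⟩
    have hqp : q = p := (Nat.prime_dvd_prime_iff_eq hq hp).mp
      (hq.dvd_of_dvd_pow ((dvd_pow_self q (by omega)).trans hd))
    subst hqp
    exact absurd ((Nat.pow_dvd_pow_iff_le_right hq.one_lt).mp hd) (by omega)

/-- Being `k`-free is multiplicative over coprime factors, so there is an Euler product whose local
factor is the geometric sum cut off at exponent k. -/
lemma hasSum_invPow_kFree {s : ℝ} (hs : 0 ≤ s) {k : ℕ} (hk : 2 ≤ k) (N : ℕ) :
    HasSum ((Omega N).indicator ((kFree k).indicator (invPow s)))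
      (∏ p ∈ (Nat.nth Nat.Prime N).primesBelow,
        (1 - invPow s p ^ k) * (1 - invPow s p)⁻¹) := by
  set F : ℕ → ℝ := (kFree k).indicator (invPow s)
  have hF1 : F 1 = 1 := by simp [F, one_mem_kFree hk]
  have hFmul : ∀ {m n : ℕ}, m.Coprime n → F (m * n) = F m * F n := by
    intro m n h
    have hiff := mul_mem_kFree_iff hk h
    by_cases h1 : m ∈ kFree k <;> by_cases h2 : n ∈ kFree k <;> simp [F, hiff, h1, h2]
  have hFpow : ∀ {p : ℕ}, p.Prime → ∀ j, F (p ^ j) = if j < k then invPow s p ^ j else 0 := by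
    intro p hp j
    simp only [F, Set.indicator, prime_pow_mem_kFree_iff hk hp, map_pow]
  have hFsum : ∀ {p : ℕ}, p.Prime →
      HasSum (fun j => F (p ^ j)) (∑ j ∈ Finset.range k, F (p ^ j)) := by
    intro p hp
    refine hasSum_sum_of_ne_finset_zero fun j hj => ?_
    rw [hFpow hp, if_neg (by simpa using hj)]
  have h := (EulerProduct.summable_and_hasSum_smoothNumbers_prod_primesBelow_tsum hF1 hFmul
    (fun hp => (hFsum hp).summable.norm) (Nat.nth Nat.Prime N)).2
  rw [Omega_eq_smoothNumbers, ← hasSum_subtype_iff_indicator]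
  convert! h using 1
  refine Finset.prod_congr rfl fun p hp => ?_
  have hp := Nat.prime_of_mem_primesBelow hp
  have hle := invPow_prime_le_half hs hp
  rw [(hFsum hp).tsum_eq, Finset.sum_congr rfl fun j hj => by
    rw [hFpow hp, if_pos (Finset.mem_range.mp hj)], geom_sum_eq (by linarith), ← neg_div_neg_eq,
    neg_sub, neg_sub, div_eq_mul_inv]

/-! ### Laplace transforms of the measures `P_N` and `P_N^{(k)}` -/

lemma weight_toReal (N n : ℕ) : (weight N n).toReal = (Omega N).indicator (invPow 0) n := by
  simp only [weight, Set.indicator]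
  split_ifs <;> simp [invPow_zero_apply]

lemma tsum_weight_toReal (N : ℕ) : (∑' n, weight N n).toReal =
    ∏ p ∈ (Nat.nth Nat.Prime N).primesBelow, (1 - invPow 0 p)⁻¹ := by
  rw [ENNReal.tsum_toReal_eq fun n => ENNReal.ne_top_of_tsum_ne_top (tsum_weight_ne_top N) n]
  simp_rw [weight_toReal]
  exact (hasSum_invPow le_rfl N).tsum_eq

lemma integrable_exp_log {μ : Measure ℕ} [IsFiniteMeasure μ] {s : ℝ} (hs : 0 ≤ s) :
    Integrable (fun n : ℕ => Real.exp (-s * Real.log n)) μ := by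
  refine Integrable.of_bound (Measurable.of_discrete.aestronglyMeasurable) 1
    (.of_forall fun n => ?_)
  rw [Real.norm_of_nonneg (Real.exp_pos _).le]
  exact Real.exp_le_one_iff.mpr (by nlinarith [Real.log_natCast_nonneg n])

/-- For `A = kFree k`, the case s = 0 gives the probability by which the conditional measure is
normalized. -/
lemma setIntegral_exp_log {s : ℝ} (hs : 0 ≤ s) (N : ℕ) (A : Set ℕ) :
    ∫ n in A, Real.exp (-s * Real.log n) ∂P N =
      (∑' n, (Omega N).indicator (A.indicator (invPow s)) n) /
        ∏ p ∈ (Nat.nth Nat.Prime N).primesBelow, (1 - invPow 0 p)⁻¹ := by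
  have hi : Integrable (A.indicator fun n : ℕ => Real.exp (-s * Real.log n)) (P N) :=
    (integrable_exp_log hs).indicator (MeasurableSet.of_discrete)
  rw [← integral_indicator MeasurableSet.of_discrete]
  unfold P at hi ⊢
  rw [PMF.integral_eq_tsum _ _ hi, ← tsum_div_const]
  refine tsum_congr fun n => ?_
  rw [PMF.normalize_apply, ENNReal.toReal_mul, ENNReal.toReal_inv, tsum_weight_toReal,
    weight_toReal, smul_eq_mul, div_eq_mul_inv]
  generalize (∏ p ∈ (Nat.nth Nat.Prime N).primesBelow, (1 - invPow 0 p)⁻¹)⁻¹ = Z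
  simp only [Set.indicator, invPow_zero_apply, invPow_apply s]
  split_ifs <;> ring

lemma prod_one_sub_invPow_ne_zero {s : ℝ} (hs : 0 ≤ s) (N : ℕ) :
    ∏ p ∈ (Nat.nth Nat.Prime N).primesBelow, (1 - invPow s p)⁻¹ ≠ 0 := by
  refine Finset.prod_ne_zero_iff.mpr fun p hp => inv_ne_zero ?_
  linarith [invPow_prime_le_half hs (Nat.prime_of_mem_primesBelow hp)]

lemma integral_exp_log_P {s : ℝ} (hs : 0 ≤ s) (N : ℕ) :
    ∫ n, Real.exp (-s * Real.log n) ∂P N =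
      ∏ p ∈ (Nat.nth Nat.Prime N).primesBelow, (1 - invPow 0 p) / (1 - invPow s p) := by
  have h := setIntegral_exp_log hs N Set.univ
  rw [Measure.restrict_univ, Set.indicator_univ, (hasSum_invPow hs N).tsum_eq,
    ← Finset.prod_div_distrib] at h
  rw [h]
  refine Finset.prod_congr rfl fun p _ => ?_
  rw [div_inv_eq_mul, mul_comm, div_eq_mul_inv]

lemma integral_exp_log_Pfree {s : ℝ} (hs : 0 ≤ s) {k : ℕ} (hk : 2 ≤ k) (N : ℕ) :
    ∫ n, Real.exp (-s * Real.log n) ∂Pfree k N =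
      (∏ p ∈ (Nat.nth Nat.Prime N).primesBelow, (1 - invPow 0 p) / (1 - invPow s p)) *
        ∏ p ∈ (Nat.nth Nat.Prime N).primesBelow,
          (1 - invPow s p ^ k) / (1 - invPow 0 p ^ k) := by
  have h1 := setIntegral_exp_log hs N (kFree k)
  have h0 := setIntegral_exp_log le_rfl N (kFree k)
  rw [(hasSum_invPow_kFree hs hk N).tsum_eq] at h1
  rw [(hasSum_invPow_kFree le_rfl hk N).tsum_eq] at h0
  simp only [neg_zero, zero_mul, Real.exp_zero, integral_const, smul_eq_mul, mul_one,
    measureReal_restrict_apply_univ] at h0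
  rw [Pfree, ProbabilityTheory.cond, integral_smul_measure, ENNReal.toReal_inv, smul_eq_mul, h1,
    ← measureReal_def, h0, inv_mul_eq_div, div_div_div_cancel_right₀
    (prod_one_sub_invPow_ne_zero le_rfl N), ← Finset.prod_div_distrib, ← Finset.prod_mul_distrib]
  refine Finset.prod_congr rfl fun p _ => ?_
  rw [mul_div_mul_comm, inv_div_inv, mul_comm]

/-! ### Limits of the Euler products -/

lemma sub_le_log_sub_log {a b : ℝ} (hb : 0 ≤ b) (hba : b ≤ a) (ha : a < 1) :
    a - b ≤ Real.log (1 - b) - Real.log (1 - a) := by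
  have hb1 : 0 < 1 - b := by linarith
  have h := Real.log_le_sub_one_of_pos (div_pos (sub_pos.mpr ha) hb1)
  rw [Real.log_div (by linarith) hb1.ne'] at h
  have h2 : (1 - a) / (1 - b) - 1 ≤ -(a - b) := by
    rw [div_sub_one hb1.ne', div_le_iff₀ hb1]
    nlinarith
  linarith

lemma log_sub_log_le {a b : ℝ} (hba : b ≤ a) (ha : a < 1) :
    Real.log (1 - b) - Real.log (1 - a) ≤ (a - b) / (1 - a) := by
  have ha1 : 0 < 1 - a := by linarith
  have h := Real.log_le_sub_one_of_pos (div_pos (by linarith : 0 < 1 - b) ha1)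
  rw [Real.log_div (by linarith) ha1.ne', div_sub_one ha1.ne'] at h
  simpa using h

lemma invPow_zero_sub_invPow {s : ℝ} (p : ℕ) :
    invPow 0 p - invPow s p = (p : ℝ)⁻¹ * (1 - Real.exp (-s * Real.log p)) := by
  rw [invPow_zero_apply, invPow_apply]
  ring

lemma invPow_zero_sub_invPow_le (s : ℝ) (p : ℕ) :
    invPow 0 p - invPow s p ≤ s * Real.log p / p := by
  rw [invPow_zero_sub_invPow, div_eq_inv_mul]
  refine mul_le_mul_of_nonneg_left ?_ (by positivity)
  linarith [Real.add_one_le_exp (-s * Real.log p)]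

lemma invPow_le_invPow_zero {s : ℝ} (hs : 0 ≤ s) (p : ℕ) : invPow s p ≤ invPow 0 p := by
  rw [invPow_zero_apply]
  exact invPow_le hs p

/-- With a = 1/p and b = p^(-1-s), linearizing the logarithms costs at most 2a(a - b), and a - b ≤ s
(log p)/p. The bound is linear in s, so it vanishes for s = t / log N. -/
lemma abs_sum_log_sub_log_sub_le {s : ℝ} (hs : 0 ≤ s) (n : ℕ) :
    |∑ p ∈ n.primesBelow, (Real.log (1 - invPow s p) - Real.log (1 - invPow 0 p)) -
      ∑ p ∈ n.primesBelow, (p : ℝ)⁻¹ * (1 - Real.exp (-s * Real.log p))| ≤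
      2 * s * logSqConst := by
  rw [← Finset.sum_sub_distrib]
  have hle : ∀ p ∈ n.primesBelow, |Real.log (1 - invPow s p) - Real.log (1 - invPow 0 p) -
      (p : ℝ)⁻¹ * (1 - Real.exp (-s * Real.log p))| ≤ 2 * s * (Real.log p / (p : ℝ) ^ 2) := by
    intro p hp
    have hp := Nat.prime_of_mem_primesBelow hp
    have ha := invPow_prime_le_half le_rfl hp
    have hba := invPow_le_invPow_zero hs p
    have h1 := sub_le_log_sub_log (invPow_nonneg s p) hba (by linarith)
    have h2 := log_sub_log_le hba (by linarith)
    have h3 := invPow_zero_sub_invPow_le s p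
    -- Uses 1/(1 - a) ≤ 1 + 2a for 0 ≤ a ≤ 1/2.
    have h4 : (invPow 0 p - invPow s p) / (1 - invPow 0 p) ≤
        (invPow 0 p - invPow s p) * (1 + 2 * invPow 0 p) := by
      rw [div_le_iff₀ (by linarith), mul_assoc]
      refine le_mul_of_one_le_right (by linarith) ?_
      nlinarith [invPow_nonneg 0 p]
    have h5 : 2 * invPow 0 p * (invPow 0 p - invPow s p) ≤
        2 * s * (Real.log p / (p : ℝ) ^ 2) := by
      calc 2 * invPow 0 p * (invPow 0 p - invPow s p) ≤ 2 * invPow 0 p * (s * Real.log p / p) := by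
            have := invPow_nonneg 0 p
            gcongr
        _ = 2 * s * (Real.log p / (p : ℝ) ^ 2) := by
            rw [invPow_zero_apply]
            ring
    rw [← invPow_zero_sub_invPow, abs_of_nonneg (by linarith)]
    linarith
  refine (Finset.abs_sum_le_sum_abs _ _).trans ((Finset.sum_le_sum hle).trans ?_)
  rw [← Finset.mul_sum]
  exact mul_le_mul_of_nonneg_left (sum_log_div_sq_le _) (by positivity)

/-- Each of the k terms of the cofactor of a - b is at most a^(k-1), which is at most a because k ≥
2. This spare factor a = 1/p makes the sum over primes converge. -/
lemma pow_sub_pow_le {a b : ℝ} (hb : 0 ≤ b) (hba : b ≤ a) (ha : a ≤ 1) {k : ℕ} (hk : 2 ≤ k) :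
    a ^ k - b ^ k ≤ k * a * (a - b) := by
  have ha0 : 0 ≤ a := hb.trans hba
  rw [← (Commute.all a b).mul_geom_sum₂, mul_comm]
  refine mul_le_mul_of_nonneg_right ?_ (by linarith)
  have h : ∀ i ∈ Finset.range k, a ^ i * b ^ (k - 1 - i) ≤ a := by
    intro i hi
    have hi := Finset.mem_range.mp hi
    calc a ^ i * b ^ (k - 1 - i) ≤ a ^ i * a ^ (k - 1 - i) := by gcongr
      _ = a ^ (k - 1) := by rw [← pow_add, Nat.add_sub_cancel' (by omega)]
      _ ≤ a ^ 1 := pow_le_pow_of_le_one ha0 ha (by omega)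
      _ = a := pow_one a
  simpa using Finset.sum_le_sum h

lemma abs_sum_log_pow_sub_le {s : ℝ} (hs : 0 ≤ s) {k : ℕ} (hk : 2 ≤ k) (n : ℕ) :
    |∑ p ∈ n.primesBelow, (Real.log (1 - invPow s p ^ k) - Real.log (1 - invPow 0 p ^ k))| ≤
      2 * k * s * logSqConst := by
  have hle : ∀ p ∈ n.primesBelow,
      |Real.log (1 - invPow s p ^ k) - Real.log (1 - invPow 0 p ^ k)| ≤
        2 * k * s * (Real.log p / (p : ℝ) ^ 2) := by
    intro p hp
    have hp := Nat.prime_of_mem_primesBelow hp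
    have ha := invPow_prime_le_half le_rfl hp
    have ha0 := invPow_nonneg 0 p
    have hb0 := invPow_nonneg s p
    have hba := invPow_le_invPow_zero hs p
    have hpow : invPow s p ^ k ≤ invPow 0 p ^ k := pow_le_pow_left₀ hb0 hba k
    have hak : invPow 0 p ^ k ≤ 1 / 2 :=
      (pow_le_of_le_one ha0 (by linarith) (by omega)).trans ha
    have h1 := sub_le_log_sub_log (pow_nonneg hb0 k) hpow (by linarith)
    have h2 := log_sub_log_le hpow (by linarith)
    have h3 := pow_sub_pow_le hb0 hba (by linarith) hk
    have h4 : (invPow 0 p ^ k - invPow s p ^ k) / (1 - invPow 0 p ^ k) ≤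
        2 * (invPow 0 p ^ k - invPow s p ^ k) := by
      rw [div_le_iff₀ (by linarith)]
      nlinarith
    rw [abs_of_nonneg (by linarith)]
    calc _ ≤ 2 * (k * invPow 0 p * (invPow 0 p - invPow s p)) := by linarith
      _ ≤ 2 * (k * invPow 0 p * (s * Real.log p / p)) := by
        gcongr
        exact invPow_zero_sub_invPow_le s p
      _ = _ := by
        rw [invPow_zero_apply]
        ring
  refine (Finset.abs_sum_le_sum_abs _ _).trans ((Finset.sum_le_sum hle).trans ?_)
  rw [← Finset.mul_sum]
  exact mul_le_mul_of_nonneg_left (sum_log_div_sq_le _) (by positivity)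

lemma tendsto_prod_div {t : ℝ} (ht : 0 ≤ t) :
    Tendsto (fun N : ℕ => ∏ p ∈ (Nat.nth Nat.Prime N).primesBelow,
      (1 - invPow 0 p) / (1 - invPow (t / Real.log N) p)) atTop
      (𝓝 (Real.exp (-laplaceExponent t))) := by
  have herr : Tendsto (fun N : ℕ => 2 * (t / Real.log N) * logSqConst) atTop (𝓝 0) := by
    simpa using ((tendsto_const_nhds.div_atTop tendsto_log_natCast).const_mul 2).mul_const
      logSqConst
  have hsum := tendsto_sum_primesBelow ht
  have hlog : Tendsto (fun N : ℕ => ∑ p ∈ (Nat.nth Nat.Prime N).primesBelow,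
      (Real.log (1 - invPow (t / Real.log N) p) - Real.log (1 - invPow 0 p))) atTop
      (𝓝 (laplaceExponent t)) := by
    refine (tendsto_iff_of_dist (squeeze_zero (fun _ => dist_nonneg) (fun N => ?_) herr)).mpr hsum
    have h := abs_sum_log_sub_log_sub_le (div_nonneg ht (Real.log_natCast_nonneg N))
      (Nat.nth Nat.Prime N)
    rw [Real.dist_eq]
    convert! h using 7
    ring
  refine ((Real.continuous_exp.tendsto _).comp hlog.neg).congr fun N => ?_
  rw [Function.comp_apply, ← Finset.sum_neg_distrib, Real.exp_sum]
  refine Finset.prod_congr rfl fun p hp => ?_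
  have hp := Nat.prime_of_mem_primesBelow hp
  have ha := invPow_prime_le_half le_rfl hp
  have hb := invPow_prime_le_half (div_nonneg ht (Real.log_natCast_nonneg N)) hp
  rw [neg_sub, Real.exp_sub, Real.exp_log (by linarith), Real.exp_log (by linarith)]

lemma tendsto_prod_pow_div {t : ℝ} (ht : 0 ≤ t) {k : ℕ} (hk : 2 ≤ k) :
    Tendsto (fun N : ℕ => ∏ p ∈ (Nat.nth Nat.Prime N).primesBelow,
      (1 - invPow (t / Real.log N) p ^ k) / (1 - invPow 0 p ^ k)) atTop (𝓝 1) := by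
  have herr : Tendsto (fun N : ℕ => 2 * k * (t / Real.log N) * logSqConst) atTop (𝓝 0) := by
    simpa using ((tendsto_const_nhds.div_atTop tendsto_log_natCast).const_mul
      (2 * (k : ℝ))).mul_const logSqConst
  have hlog : Tendsto (fun N : ℕ => ∑ p ∈ (Nat.nth Nat.Prime N).primesBelow,
      (Real.log (1 - invPow (t / Real.log N) p ^ k) - Real.log (1 - invPow 0 p ^ k))) atTop
      (𝓝 0) :=
    squeeze_zero_norm (fun N => abs_sum_log_pow_sub_le
      (div_nonneg ht (Real.log_natCast_nonneg N)) hk (Nat.nth Nat.Prime N)) herr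
  have h := (Real.continuous_exp.tendsto 0).comp hlog
  rw [Real.exp_zero] at h
  refine h.congr fun N => ?_
  rw [Function.comp_apply, Real.exp_sum]
  refine Finset.prod_congr rfl fun p hp => ?_
  have hp := Nat.prime_of_mem_primesBelow hp
  have hlt : ∀ s : ℝ, 0 ≤ s → 0 < 1 - invPow s p ^ k := fun s hs => by
    have h1 := invPow_prime_le_half hs hp
    have h2 := pow_le_of_le_one (invPow_nonneg s p) (by linarith) (show k ≠ 0 by omega)
    linarith
  rw [Real.exp_sub, Real.exp_log (hlt _ (div_nonneg ht (Real.log_natCast_nonneg N))),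
    Real.exp_log (hlt 0 le_rfl)]

lemma tendsto_laplace_P {t : ℝ} (ht : 0 ≤ t) :
    Tendsto (fun N : ℕ => ∫ n : ℕ, Real.exp (-t * (Real.log n / Real.log N)) ∂P N) atTop
      (𝓝 (Real.exp (-laplaceExponent t))) := by
  refine (tendsto_prod_div ht).congr fun N => ?_
  rw [← integral_exp_log_P (div_nonneg ht (Real.log_natCast_nonneg N))]
  congr 1
  funext n
  ring_nf

lemma tendsto_laplace_Pfree {t : ℝ} (ht : 0 ≤ t) {k : ℕ} (hk : 2 ≤ k) :
    Tendsto (fun N : ℕ => ∫ n : ℕ, Real.exp (-t * (Real.log n / Real.log N)) ∂Pfree k N) atTop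
      (𝓝 (Real.exp (-laplaceExponent t))) := by
  have h := (tendsto_prod_div ht).mul (tendsto_prod_pow_div ht hk)
  rw [mul_one] at h
  refine h.congr fun N => ?_
  rw [← integral_exp_log_Pfree (div_nonneg ht (Real.log_natCast_nonneg N)) hk]
  congr 1
  funext n
  ring_nf

/-! ### Convergence in distribution -/

lemma tendstoInDistribution_of_tendsto_laplace {Q : ℕ → Measure ℕ}
    [∀ N, IsProbabilityMeasure (Q N)] [IsProbabilityMeasure dickmanMeasure]
    (h : ∀ t : ℝ, 0 ≤ t →
      Tendsto (fun N : ℕ => ∫ n : ℕ, Real.exp (-t * (Real.log n / Real.log N)) ∂Q N) atTop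
        (𝓝 (Real.exp (-laplaceExponent t)))) :
    TendstoInDistribution (fun (N n : ℕ) => Real.log n / Real.log N) atTop id Q
      dickmanMeasure := by
  have hm : ∀ N : ℕ, Measurable fun n : ℕ => Real.log n / Real.log N :=
    fun _ => Measurable.of_discrete
  have hprob : ∀ N : ℕ, IsProbabilityMeasure
      ((Q N).map fun n : ℕ => Real.log n / Real.log N) :=
    fun N => Measure.isProbabilityMeasure_map (hm N).aemeasurable
  refine ⟨fun N => (hm N).aemeasurable, aemeasurable_id, ?_⟩
  refine ProbabilityMeasure.tendsto_iff_forall_integral_tendsto.mpr fun f => ?_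
  simp only [ProbabilityMeasure.coe_mk, Measure.map_id]
  refine tendsto_integral_of_tendsto_laplace (fun N => ?_) ae_nonneg_dickmanMeasure
    (fun t ht => ?_) f
  · rw [ae_map_iff (hm N).aemeasurable measurableSet_Ici]
    -- For N ≤ 1 the denominator is 0 and so is the quotient; nonnegativity persists.
    exact .of_forall fun n =>
      div_nonneg (Real.log_natCast_nonneg n) (Real.log_natCast_nonneg N)
  · rw [integral_exp_dickmanMeasure ht]
    refine (h t ht).congr fun N => ?_
    rw [integral_map (hm N).aemeasurable (Measurable.aestronglyMeasurable (by fun_prop))]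

end DickmanLimit

/-- Nonnegativity of ρ is stated separately because `ENNReal.ofReal` would hide negative values of
the density. Total mass one is bound by `∃` because convergence in distribution needs it as an
instance. -/
theorem mainTheorem1 :
    (∀ x : ℝ, 0 < x → 0 ≤ DickmanLimit.dickmanRho x) ∧
    ∃ _ : IsProbabilityMeasure DickmanLimit.dickmanMeasure,
      TendstoInDistribution (fun (N n : ℕ) => Real.log n / Real.log N) atTop id
        (fun N => DickmanLimit.P N) DickmanLimit.dickmanMeasure ∧
      (∀ (k : ℕ) [k.AtLeastTwo],
        TendstoInDistribution (fun (N n : ℕ) => Real.log n / Real.log N) atTop id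
          (fun N => DickmanLimit.Pfree k N) DickmanLimit.dickmanMeasure) ∧
      (∀ t : ℝ, 0 ≤ t →
        Tendsto (fun N : ℕ => ∫ n, Real.exp (-t * (Real.log n / Real.log N)) ∂DickmanLimit.P N)
          atTop (𝓝 (Real.exp (-∫ x in (0 : ℝ)..1, (1 - Real.exp (-t * x)) / x)))) ∧
      (∀ (k : ℕ) [k.AtLeastTwo], ∀ t : ℝ, 0 ≤ t →
        Tendsto
          (fun N : ℕ => ∫ n, Real.exp (-t * (Real.log n / Real.log N)) ∂DickmanLimit.Pfree k N)
          atTop (𝓝 (Real.exp (-∫ x in (0 : ℝ)..1, (1 - Real.exp (-t * x)) / x)))) := by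
  have hprob := DickmanLimit.isProbabilityMeasure_dickmanMeasure
  refine ⟨fun x _ => (DickmanLimit.dickmanRho_pos x).le, hprob, ?_, fun k hk => ?_,
    fun t ht => DickmanLimit.tendsto_laplace_P ht,
    fun k hk t ht => DickmanLimit.tendsto_laplace_Pfree ht hk.prop⟩
  · exact DickmanLimit.tendstoInDistribution_of_tendsto_laplace
      fun t ht => DickmanLimit.tendsto_laplace_P ht
  · exact DickmanLimit.tendstoInDistribution_of_tendsto_laplace
      fun t ht => DickmanLimit.tendsto_laplace_Pfree ht hk.prop
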